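/- Let $G=\mathbb{R}^n\times\mathbb{R}^m$ be a Carnot group of step $2$ in exponential coordinates. That is, $m\geq 1$ and the group law is $$(h_1,v_1)\star(h_2,v_2)=\bigl(h_1+h_2,\;v_1+v_2+\tfrac12\,\omega(h_1,h_2)\bigr),$$ where $\omega:\mathbb{R}^n\times\mathbb{R}^n\to\mathbb{R}^m$ is a skew-symmetric bilinear map whose values span $\mathbb{R}^m$. Let $L^2(G)$ be the complex $L^2$ space with respect to Lebesgue measure on $\mathbb{R}^{n+m}$ (a Haar measure of $G$). For $i=1,\dots,n$ let $Z_i$ be the left-invariant vector field $Z_if(g)=\frac{d}{dt}\big|_{t=0}f(g\star(te_i,0))$, where $e_1,\dots,e_n$ is the standard basis of $\mathbb{R}^n$. Let the sub-Laplacian $\Delta_{\mathcal H}$ be the closure in $L^2(G)$ of the operator $\sum_{i=1}^n Z_i^2$ with domain $C_c^\infty(G)$, and let $\mathbb{Q}_t=e^{t\Delta_{\mathcal H}}$, $t\geq 0$, be the horizontal heat semigroup, that is, the strongly continuous semigroup on $L^2(G)$ with infinitesimal generator $\Delta_{\mathcal H}$. Then for every $t>0$ $$\sigma(\mathbb{Q}_t;L^2(G))=\sigma_{\rm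 c}(\mathbb{Q}_t;L^2(G))=[0,1].$$ Here the continuous spectrum $\sigma_{\rm c}(A;X)$ of a bounded operator $A$ on a Banach space $X$ is the set of $\zeta\in\sigma(A;X)$ for which $A-\zeta I$ is injective, is not surjective, and has dense range. -/

import Mathlib

open MeasureTheory Filter Topology
open scoped ContDiff NNReal

/-- The underlying space `ℝⁿ × ℝᵐ` of a step 2 Carnot group in exponential coordinates `(h, v)`,
with `h` the horizontal and `v` the vertical component. The measure `volume` on it is Lebesgue
measure, which is a (bi-invariant) Haar measure of the group. -/
abbrev CarnotPoint (n m : ℕ) : Type := EuclideanSpace ℝ (Fin n) × EuclideanSpace ℝ (Fin m)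

/-- A step 2 Carnot group in exponential coordinates: the Lie algebra is `𝓗 ⊕ 𝓥` with `𝓗 = ℝⁿ`
(the standard basis being orthonormal for the sub-Riemannian metric) and `𝓥 = ℝᵐ ≠ 0`. The Lie
bracket is `[(h, v), (h', v')] = (0, ω(h, h'))` for a skew-symmetric bilinear map `ω`, and
`[𝓗, 𝓗] = 𝓥`. -/
structure StepTwoCarnotGroup (n m : ℕ) where
  /-- the map `ω` -/
  bracket : EuclideanSpace ℝ (Fin n) →ₗ[ℝ] EuclideanSpace ℝ (Fin n) →ₗ[ℝ] EuclideanSpace ℝ (Fin m)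
  bracket_self : ∀ h, bracket h h = 0
  span_bracket : Submodule.span ℝ {v | ∃ h h', bracket h h' = v} = ⊤
  vertical_pos : 0 < m

namespace StepTwoCarnotGroup

variable {n m : ℕ} (G : StepTwoCarnotGroup n m)

/-- The group law `(h₁, v₁) ⋆ (h₂, v₂) = (h₁ + h₂, v₁ + v₂ + ω(h₁, h₂) / 2)`. -/
noncomputable def mul (g g' : CarnotPoint n m) : CarnotPoint n m :=
  (g.1 + g'.1, g.2 + g'.2 + (1 / 2 : ℝ) • G.bracket g.1 g'.1)

/-- `⋆` is a group law with unit `0` and inverse `g ↦ -g`. -/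
noncomputable abbrev group : Group (CarnotPoint n m) :=
  letI : Mul (CarnotPoint n m) := ⟨G.mul⟩
  letI : One (CarnotPoint n m) := ⟨0⟩
  letI : Inv (CarnotPoint n m) := ⟨fun g => -g⟩
  Group.ofLeftAxioms
    (by
      intro a b c
      change G.mul (G.mul a b) c = G.mul a (G.mul b c)
      refine Prod.ext ?_ ?_
      · simp only [mul]
        abel
      · simp only [mul, map_add, LinearMap.add_apply, smul_add]
        abel)
    (by
      intro a
      change G.mul 0 a = a
      simp [mul])
    (by
      intro a
      change G.mul (-a) a = 0
      simp [mul, G.bracket_self, Prod.ext_iff])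

/-- The left-invariant vector field `Z f (g) = d/dt|_{t = 0} f (g ⋆ exp (t Z))`; in exponential
coordinates `exp` is the identity. -/
noncomputable def leftInvariant (Z : CarnotPoint n m) (f : CarnotPoint n m → ℂ)
    (g : CarnotPoint n m) : ℂ :=
  deriv (fun t : ℝ => f (G.mul g (t • Z))) 0

/-- The horizontal basis vectors `Z₁, …, Zₙ` of the Lie algebra. -/
noncomputable def horizontalBasis (m : ℕ) {n : ℕ} (i : Fin n) : CarnotPoint n m :=
  (EuclideanSpace.single i 1, 0)

/-- The differential expression `Δ_𝓗 f = ∑ᵢ Zᵢ (Zᵢ f)`. -/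
noncomputable def subLaplacianFun (f : CarnotPoint n m → ℂ) : CarnotPoint n m → ℂ :=
  fun g => ∑ i : Fin n,
    G.leftInvariant (horizontalBasis m i) (G.leftInvariant (horizontalBasis m i) f) g

end StepTwoCarnotGroup

/-- The space `C_c^∞(G)` of complex-valued, smooth, compactly supported functions. -/
def carnotTestFunctions (n m : ℕ) : Submodule ℂ (CarnotPoint n m → ℂ) where
  carrier := {f | ContDiff ℝ ∞ f ∧ HasCompactSupport f}
  add_mem' hf hg := ⟨hf.1.add hg.1, hf.2.add hg.2⟩
  zero_mem' := ⟨contDiff_const, HasCompactSupport.zero⟩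
  smul_mem' c _ hf := ⟨contDiff_const.smul hf.1, hf.2.smul_left (f := fun _ => c)⟩

/-- The Hilbert space `L²(G)`. -/
abbrev CarnotL2 (n m : ℕ) : Type := Lp ℂ 2 (volume : Measure (CarnotPoint n m))

theorem carnotTestFunctions_memLp {n m : ℕ} (f : carnotTestFunctions n m) :
    MemLp (f : CarnotPoint n m → ℂ) 2 volume :=
  f.2.1.continuous.memLp_of_hasCompactSupport f.2.2

/-- The inclusion of `C_c^∞(G)` in `L²(G)`. -/
noncomputable def carnotTestToL2 (n m : ℕ) : carnotTestFunctions n m →ₗ[ℂ] CarnotL2 n m where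
  toFun f := (carnotTestFunctions_memLp f).toLp _
  map_add' _ _ := rfl
  map_smul' _ _ := rfl

theorem carnotTestToL2_injective (n m : ℕ) : Function.Injective (carnotTestToL2 n m) := by
  intro f g h
  have h1 := (MemLp.toLp_eq_toLp_iff (carnotTestFunctions_memLp f)
    (carnotTestFunctions_memLp g)).1 h
  exact Subtype.ext (Continuous.ae_eq_iff_eq volume f.2.1.continuous g.2.1.continuous |>.1 h1)

namespace StepTwoCarnotGroup

variable {n m : ℕ} (G : StepTwoCarnotGroup n m)

theorem leftInvariant_eq_fderiv (Z : CarnotPoint n m) {f : CarnotPoint n m → ℂ}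
    (hf : Differentiable ℝ f) (g : CarnotPoint n m) :
    G.leftInvariant Z f g = fderiv ℝ f g (Z.1, Z.2 + (1 / 2 : ℝ) • G.bracket g.1 Z.1) := by
  have hcurve : HasDerivAt (fun t : ℝ => G.mul g (t • Z))
      (Z.1, Z.2 + (1 / 2 : ℝ) • G.bracket g.1 Z.1) 0 := by
    have h : (fun t : ℝ => G.mul g (t • Z)) =
        fun t : ℝ => g + t • (Z.1, Z.2 + (1 / 2 : ℝ) • G.bracket g.1 Z.1) := by
      funext t
      refine Prod.ext ?_ ?_
      · simp [mul]
      · simp [mul, smul_smul, add_assoc, mul_comm]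
    rw [h]
    simpa using ((hasDerivAt_id (0 : ℝ)).smul_const
      (Z.1, Z.2 + (1 / 2 : ℝ) • G.bracket g.1 Z.1)).const_add g
  have h0 : G.mul g ((0 : ℝ) • Z) = g := by simp [mul]
  have hf' : HasFDerivAt f (fderiv ℝ f g) (G.mul g ((0 : ℝ) • Z)) := by
    rw [h0]
    exact (hf g).hasFDerivAt
  exact (hf'.comp_hasDerivAt (0 : ℝ) hcurve).deriv

theorem leftInvariant_mem (Z : CarnotPoint n m) {f : CarnotPoint n m → ℂ}
    (hf : f ∈ carnotTestFunctions n m) : G.leftInvariant Z f ∈ carnotTestFunctions n m := by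
  have hd : Differentiable ℝ f := hf.1.differentiable (by simp)
  have he : G.leftInvariant Z f =
      fun g => fderiv ℝ f g (Z.1, Z.2 + (1 / 2 : ℝ) • G.bracket g.1 Z.1) :=
    funext fun g => G.leftInvariant_eq_fderiv Z hd g
  rw [he]
  constructor
  · have h1 : ContDiff ℝ ∞ (fderiv ℝ f) := hf.1.fderiv_right (by simp)
    have h2 : ContDiff ℝ ∞ (fun g : CarnotPoint n m => G.bracket g.1 Z.1) :=
      ((G.bracket.flip Z.1).toContinuousLinearMap.contDiff).comp contDiff_fst
    exact h1.clm_apply (contDiff_const.prodMk (contDiff_const.add (h2.const_smul _)))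
  · refine (hf.2.fderiv (𝕜 := ℝ)).mono ?_
    intro g hg hz
    exact hg (by simp [hz])

/-- `Zᵢ` as a linear operator on `C_c^∞(G)`. -/
noncomputable def leftInvariantTest (Z : CarnotPoint n m) :
    carnotTestFunctions n m →ₗ[ℂ] carnotTestFunctions n m where
  toFun f := ⟨G.leftInvariant Z f, G.leftInvariant_mem Z f.2⟩
  map_add' f g := by
    have hf : Differentiable ℝ (f : CarnotPoint n m → ℂ) := f.2.1.differentiable (by simp)
    have hg : Differentiable ℝ (g : CarnotPoint n m → ℂ) := g.2.1.differentiable (by simp)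
    refine Subtype.ext (funext fun x => ?_)
    change G.leftInvariant Z ((f : CarnotPoint n m → ℂ) + g) x =
      G.leftInvariant Z f x + G.leftInvariant Z g x
    rw [G.leftInvariant_eq_fderiv Z (hf.add hg), G.leftInvariant_eq_fderiv Z hf,
      G.leftInvariant_eq_fderiv Z hg, fderiv_add (hf x) (hg x)]
    rfl
  map_smul' c f := by
    have hf : Differentiable ℝ (f : CarnotPoint n m → ℂ) := f.2.1.differentiable (by simp)
    refine Subtype.ext (funext fun x => ?_)
    change G.leftInvariant Z (c • (f : CarnotPoint n m → ℂ)) x = c • G.leftInvariant Z f x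
    rw [G.leftInvariant_eq_fderiv Z (hf.const_smul c), G.leftInvariant_eq_fderiv Z hf,
      fderiv_const_smul (hf x)]
    rfl

/-- `Δ_𝓗 = ∑ᵢ Zᵢ²` as a linear operator on `C_c^∞(G)`. -/
noncomputable def subLaplacianTest : carnotTestFunctions n m →ₗ[ℂ] carnotTestFunctions n m :=
  ∑ i : Fin n, G.leftInvariantTest (horizontalBasis m i) ∘ₗ
    G.leftInvariantTest (horizontalBasis m i)

theorem subLaplacianTest_apply (f : carnotTestFunctions n m) :
    (G.subLaplacianTest f : CarnotPoint n m → ℂ) = G.subLaplacianFun f := by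
  funext g
  simp [subLaplacianTest, subLaplacianFun, leftInvariantTest]

/-- The unbounded operator `(Δ_𝓗, C_c^∞(G))` in `L²(G)`. -/
noncomputable def subLaplacianCore : CarnotL2 n m →ₗ.[ℂ] CarnotL2 n m where
  domain := LinearMap.range (carnotTestToL2 n m)
  toFun := carnotTestToL2 n m ∘ₗ G.subLaplacianTest ∘ₗ
    (LinearEquiv.ofInjective (carnotTestToL2 n m) (carnotTestToL2_injective n m)).symm.toLinearMap

theorem subLaplacianCore_apply (f : carnotTestFunctions n m) :
    G.subLaplacianCore ⟨carnotTestToL2 n m f, LinearMap.mem_range_self _ f⟩ =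
      carnotTestToL2 n m (G.subLaplacianTest f) := by
  exact congrArg (fun x => carnotTestToL2 n m (G.subLaplacianTest x))
    ((LinearEquiv.ofInjective (carnotTestToL2 n m)
      (carnotTestToL2_injective n m)).symm_apply_apply f)

/-- The sub-Laplacian `Δ_𝓗` in `L²(G)`: the closure of `(Δ_𝓗, C_c^∞(G))`. -/
noncomputable def subLaplacian : CarnotL2 n m →ₗ.[ℂ] CarnotL2 n m :=
  G.subLaplacianCore.closure

end StepTwoCarnotGroup

/-- `Q` is a strongly continuous semigroup of bounded operators on `H`. -/
structure IsC0Semigroup {H : Type*} [NormedAddCommGroup H] [NormedSpace ℂ H]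
    (Q : ℝ≥0 → H →L[ℂ] H) : Prop where
  map_zero : Q 0 = ContinuousLinearMap.id ℂ H
  map_add : ∀ s t, Q (s + t) = (Q s).comp (Q t)
  tendsto_zero : ∀ u, Tendsto (fun t => Q t u) (𝓝 0) (𝓝 u)

/-- `A` is the infinitesimal generator of `Q`: `u` lies in the domain of `A` and `A u = w` if and
only if `(Q_t u - u) / t → w` as `t ↓ 0`. -/
def HasGenerator {H : Type*} [NormedAddCommGroup H] [NormedSpace ℂ H]
    (Q : ℝ≥0 → H →L[ℂ] H) (A : H →ₗ.[ℂ] H) : Prop :=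
  ∀ u w : H, (u, w) ∈ A.graph ↔
    Tendsto (fun t : ℝ≥0 => (((t : ℝ) : ℂ))⁻¹ • (Q t u - u)) (𝓝[>] 0) (𝓝 w)

open Classical in
/-- The semigroup `e^{tA}`, `t ≥ 0`: the (unique) strongly continuous semigroup with generator `A`.
If `A` does not generate such a semigroup, this is the zero family. -/
noncomputable def semigroupGeneratedBy {H : Type*} [NormedAddCommGroup H] [NormedSpace ℂ H]
    (A : H →ₗ.[ℂ] H) : ℝ≥0 → H →L[ℂ] H :=
  if h : ∃ Q : ℝ≥0 → H →L[ℂ] H, IsC0Semigroup Q ∧ HasGenerator Q A then h.choose else 0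

/-- The horizontal heat semigroup `Q_t = e^{t Δ_𝓗}` on `L²(G)`. -/
noncomputable def StepTwoCarnotGroup.horizontalHeatSemigroup {n m : ℕ}
    (G : StepTwoCarnotGroup n m) : ℝ≥0 → CarnotL2 n m →L[ℂ] CarnotL2 n m :=
  semigroupGeneratedBy G.subLaplacian

/-- The continuous spectrum of a bounded operator `T`: the `ζ` in the spectrum such that `T - ζ`
is injective and not surjective and has dense range. -/
def continuousSpectrum {H : Type*} [NormedAddCommGroup H] [NormedSpace ℂ H]
    (T : H →L[ℂ] H) : Set ℂ :=
  {ζ | ζ ∈ spectrum ℂ T ∧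
    LinearMap.ker (T - ζ • ContinuousLinearMap.id ℂ H).toLinearMap = ⊥ ∧
    ¬ Function.Surjective (T - ζ • ContinuousLinearMap.id ℂ H) ∧
    DenseRange (T - ζ • ContinuousLinearMap.id ℂ H)}

/-!
Let `Δ` be the sub-Laplacian and `Δ₀` its restriction to test functions. The proof combines an
abstract statement on self-adjoint operators with four properties of `Δ`.

**Abstract part.** Let `A ≤ 0` be self-adjoint on a separable Hilbert space, injective, and similar
to `c A` for every `c > 0`. The resolvent `R = (1 - A)⁻¹` is bounded and self-adjoint with spectrum
in `[0, 1]`, and `exp (t A) = f_t(R)` with `f_t(r) = exp (-t (1 / r - 1))`, continuous on `[0, 1]`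
for `t > 0` when `f_t(0) = 0`. So the bounded continuous functional calculus replaces the spectral
theorem for unbounded operators; that this is the semigroup generated by `A`
(`semigroupGeneratedBy_eq_resolventSemigroup`) includes the uniqueness of that semigroup, an energy
estimate. Similarity makes `σ(R)` invariant under the maps `r ↦ c r / (1 - (1 - c) r)`, which act
transitively on `(0, 1)`; as `A ≠ 0`, `σ(R) = [0, 1]`, hence `σ(exp (t A)) = f_t([0, 1]) = [0, 1]`.
An eigenvalue of `exp (t A)` would be zero, which injectivity of the semigroup excludes, or would
come from an eigenvalue of `A`. The latter is not zero, and a nonzero one would by similarity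
produce a continuum of eigenvalues with pairwise orthogonal eigenvectors, against separability. A
self-adjoint operator without eigenvalues has only continuous spectrum.

**The sub-Laplacian.** Integration by parts along `Zᵢ` (`integral_mul_hDeriv`) shows that `Δ₀` is
symmetric and nonpositive.

* *Essential self-adjointness.* Suppose that `u` is orthogonal to the range of `1 - Δ₀`, and
  replace it by its complex conjugate. Left convolution with a test function commutes with the
  left-invariant fields, so it turns `u` into a smooth weak solution `v` of `Δ v = v`, and the
  functional `f ↦ ∫ v f` is `L²`-bounded. The Caccioppoli inequality `‖χ v‖² ≤ ∑ᵢ ‖(Zᵢ χ) v‖²`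
  along dilated cutoffs `χ` gives `v = 0`, hence `u = 0`.
* *Injectivity.* The inequality `∫ |f|² / cosh² hᵢ ≤ 2 ‖f‖ ‖Zᵢ f‖` bounds `f` locally by a
  quantity that vanishes when `Δ f = 0`, and it passes to the closure.
* *Similarity.* The dilations `(h, v) ↦ (s h, s² v)` conjugate `Δ` to `s² Δ`.
* *Separability* of `L²(G)`.
-/

/-! ### Nonpositive self-adjoint operators and their resolvents -/

/-- `A` is a nonpositive self-adjoint operator, phrased through its graph: `A` is symmetric,
`⟨A u, u⟩ ≤ 0`, and `1 - A` is onto. -/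
structure LinearPMap.IsNonposSelfAdjoint {H : Type*} [NormedAddCommGroup H]
    [InnerProductSpace ℂ H] (A : H →ₗ.[ℂ] H) : Prop where
  symm : ∀ p ∈ A.graph, ∀ q ∈ A.graph, inner ℂ p.2 q.1 = inner ℂ p.1 q.2
  nonpos : ∀ p ∈ A.graph, (inner ℂ p.1 p.2).re ≤ 0
  surj : ∀ x, ∃ p ∈ A.graph, p.1 - p.2 = x

/-- `R = (1 - A)⁻¹` is a self-adjoint operator with spectrum in `[0, 1]`. -/
structure LinearPMap.IsUnitResolvent {H : Type*} [NormedAddCommGroup H]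
    [InnerProductSpace ℂ H] [CompleteSpace H] (A : H →ₗ.[ℂ] H) (R : H →L[ℂ] H) : Prop where
  isSelfAdjoint : IsSelfAdjoint R
  spectrum_subset : spectrum ℝ R ⊆ Set.Icc 0 1
  mem_graph : ∀ u w, (u, w) ∈ A.graph ↔ R (u - w) = u

section Resolvent

variable {H : Type*} [NormedAddCommGroup H] [InnerProductSpace ℂ H]

theorem norm_le_norm_sub_of_re_inner_nonpos {u w : H} (h : (inner ℂ u w).re ≤ 0) :
    ‖u‖ ≤ ‖u - w‖ := by
  have h1 := norm_sub_sq (𝕜 := ℂ) u w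
  have h2 : RCLike.re (inner ℂ u w) ≤ 0 := h
  refine le_of_sq_le_sq ?_ (norm_nonneg _)
  nlinarith [sq_nonneg ‖w‖]

variable [CompleteSpace H] {A : H →ₗ.[ℂ] H}

theorem LinearPMap.IsNonposSelfAdjoint.exists_resolvent (hA : A.IsNonposSelfAdjoint) :
    ∃ R, A.IsUnitResolvent R := by
  have huniq : ∀ p ∈ A.graph, ∀ q ∈ A.graph, p.1 - p.2 = q.1 - q.2 → p.1 = q.1 := by
    intro p hp q hq h
    have hd := A.graph.sub_mem hp hq
    have h1 := norm_le_norm_sub_of_re_inner_nonpos (hA.nonpos _ hd)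
    have h2 : (p - q).1 - (p - q).2 = 0 := by
      rw [Prod.fst_sub, Prod.snd_sub, sub_sub_sub_comm, h, sub_self]
    rw [h2, norm_zero, norm_le_zero_iff] at h1
    exact sub_eq_zero.1 h1
  choose p hp hpx using hA.surj
  let R₀ : H →ₗ[ℂ] H :=
    { toFun := fun x => (p x).1
      map_add' := fun x y => huniq _ (hp _) _ (A.graph.add_mem (hp x) (hp y)) (by
        rw [hpx, Prod.fst_add, Prod.snd_add, add_sub_add_comm, hpx, hpx])
      map_smul' := fun c x => huniq _ (hp _) _ (A.graph.smul_mem c (hp x)) (by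
        rw [hpx, Prod.smul_fst, Prod.smul_snd, ← smul_sub, hpx]) }
  have hbound : ∀ x, ‖R₀ x‖ ≤ 1 * ‖x‖ := fun x => by
    rw [one_mul]
    have := norm_le_norm_sub_of_re_inner_nonpos (hA.nonpos _ (hp x))
    rwa [hpx] at this
  let R : H →L[ℂ] H := R₀.mkContinuous 1 hbound
  have hR : ∀ x, R x = (p x).1 := fun x => rfl
  have hsymm : (R : H →ₗ[ℂ] H).IsSymmetric := by
    intro x y
    change inner ℂ (p x).1 y = inner ℂ x (p y).1
    conv_lhs => rw [← hpx y]
    conv_rhs => rw [← hpx x]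
    rw [inner_sub_left, inner_sub_right, hA.symm _ (hp x) _ (hp y)]
  have hpos : R.IsPositive := by
    refine ⟨hsymm, fun x => ?_⟩
    rw [ContinuousLinearMap.reApplyInnerSelf_apply]
    change 0 ≤ (inner ℂ (p x).1 x).re
    have h1 : inner ℂ (p x).1 x = inner ℂ (p x).1 (p x).1 - inner ℂ (p x).1 (p x).2 := by
      rw [← inner_sub_right, hpx]
    rw [h1, Complex.sub_re, sub_nonneg]
    exact (hA.nonpos _ (hp x)).trans (inner_self_nonneg (𝕜 := ℂ))
  refine ⟨R, hpos.isSelfAdjoint, fun r hr => ⟨?_, ?_⟩, fun u w => ⟨fun h => ?_, fun h => ?_⟩⟩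
  · exact SpectrumRestricts.nnreal_iff.1 hpos.spectrumRestricts r hr
  · have h1 : ‖r‖ ≤ ‖R‖ * ‖(1 : H →L[ℂ] H)‖ := spectrum.norm_le_norm_mul_of_mem hr
    have h2 : ‖R‖ ≤ 1 := R₀.mkContinuous_norm_le zero_le_one hbound
    have h3 : ‖(1 : H →L[ℂ] H)‖ ≤ 1 := ContinuousLinearMap.norm_id_le
    have h4 : ‖R‖ * ‖(1 : H →L[ℂ] H)‖ ≤ 1 * 1 := by gcongr
    exact (le_abs_self r).trans (by rw [← Real.norm_eq_abs]; linarith)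
  · exact huniq _ (hp _) _ h (hpx _)
  · have h1 := hp (u - w)
    have h2 := hpx (u - w)
    rw [hR] at h
    rw [h] at h2
    have h3 : p (u - w) = (u, w) := Prod.ext h (by simpa using h2)
    rwa [h3] at h1

namespace LinearPMap.IsUnitResolvent

variable {R : H →L[ℂ] H} (hR : A.IsUnitResolvent R)
include hR

theorem range_mem_graph (x : H) : (R x, R x - x) ∈ A.graph := by
  rw [hR.mem_graph, sub_sub_cancel]

theorem eq_zero_of_apply_eq_zero {x : H} (hx : R x = 0) : x = 0 := by
  have h := hR.range_mem_graph x
  rw [hx, zero_sub] at h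
  simpa using A.graph_fst_eq_zero_snd h rfl

theorem denseRange : DenseRange R := by
  rw [DenseRange, ← ContinuousLinearMap.coe_coe, ← LinearMap.coe_range,
    Submodule.dense_iff_topologicalClosure_eq_top, Submodule.topologicalClosure_eq_top_iff,
    Submodule.eq_bot_iff]
  intro x hx
  refine hR.eq_zero_of_apply_eq_zero (ext_inner_right ℂ fun y => ?_)
  rw [inner_zero_left, show inner ℂ (R x) y = inner ℂ x (R y) from
    hR.isSelfAdjoint.isSymmetric x y]
  exact Submodule.inner_left_of_mem_orthogonal (LinearMap.mem_range_self _ y) hx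

end LinearPMap.IsUnitResolvent

end Resolvent

/-! ### The semigroup generated by a nonpositive self-adjoint operator -/

/-- The function with `resolventExp t (1 / (1 + x)) = exp (-t x)` for `t > 0`, `x ≥ 0`, and value
`0` at `0`: the function of the resolvent `(1 - A)⁻¹` that gives `exp (t A)`. -/
noncomputable def resolventExp (t r : ℝ) : ℝ := Real.exp t * expNegInvGlue (r / t)

theorem resolventExp_of_pos {t r : ℝ} (ht : 0 < t) (hr : 0 < r) :
    resolventExp t r = Real.exp (-(t * (r⁻¹ - 1))) := by
  have h : ¬ r / t ≤ 0 := not_le.2 (div_pos hr ht)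
  rw [resolventExp, expNegInvGlue, if_neg h, ← Real.exp_add]
  congr 1
  field_simp
  ring

theorem resolventExp_zero (t : ℝ) : resolventExp t 0 = 0 := by
  simp [resolventExp, expNegInvGlue.zero]

theorem contDiff_resolventExp (t : ℝ) : ContDiff ℝ 1 (resolventExp t) :=
  contDiff_const.mul ((expNegInvGlue.contDiff (n := 1)).comp (contDiff_id.div_const t))

theorem continuous_resolventExp (t : ℝ) : Continuous (resolventExp t) :=
  (contDiff_resolventExp t).continuous

theorem resolventExp_nonneg (t r : ℝ) : 0 ≤ resolventExp t r :=
  mul_nonneg (Real.exp_pos _).le (expNegInvGlue.nonneg _)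

theorem resolventExp_one {t : ℝ} (ht : 0 < t) : resolventExp t 1 = 1 := by
  simp [resolventExp_of_pos ht one_pos]

theorem resolventExp_le_one {t r : ℝ} (ht : 0 < t) (hr : r ∈ Set.Icc (0 : ℝ) 1) :
    resolventExp t r ≤ 1 := by
  rcases hr.1.eq_or_lt with rfl | h0
  · rw [resolventExp_zero]; exact zero_le_one
  · rw [resolventExp_of_pos ht h0]
    refine Real.exp_le_one_iff.2 (neg_nonpos.2 (mul_nonneg ht.le (sub_nonneg.2 ?_)))
    exact (one_le_inv₀ h0).2 hr.2

theorem resolventExp_add {s t r : ℝ} (hs : 0 < s) (ht : 0 < t) (hr : 0 ≤ r) :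
    resolventExp (s + t) r = resolventExp s r * resolventExp t r := by
  rcases hr.eq_or_lt with rfl | h0
  · simp [resolventExp_zero]
  · rw [resolventExp_of_pos hs h0, resolventExp_of_pos ht h0,
      resolventExp_of_pos (add_pos hs ht) h0, ← Real.exp_add]
    congr 1
    ring

theorem abs_resolventExp_sub_one_div_mul_le {t r : ℝ} (ht : 0 < t) (hr : r ∈ Set.Icc (0 : ℝ) 1) :
    |t⁻¹ * (resolventExp t r - 1) * r| ≤ 1 := by
  rcases hr.1.eq_or_lt with rfl | h0
  · simp
  set y := t * (r⁻¹ - 1) with hy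
  have hy0 : 0 ≤ y := mul_nonneg ht.le (sub_nonneg.2 ((one_le_inv₀ h0).2 hr.2))
  have h1 : resolventExp t r ≤ 1 := resolventExp_le_one ht hr
  have h2 : 1 - y ≤ resolventExp t r := by
    rw [resolventExp_of_pos ht h0, ← hy]
    linarith [Real.add_one_le_exp (-y)]
  have h3 : t⁻¹ * y * r = 1 - r := by
    rw [hy]; field_simp
  have h4 : t⁻¹ * (resolventExp t r - 1) * r ≤ 0 :=
    mul_nonpos_of_nonpos_of_nonneg
      (mul_nonpos_of_nonneg_of_nonpos (inv_pos.2 ht).le (by linarith)) h0.le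
  rw [abs_of_nonpos h4]
  have h5 : t⁻¹ * (1 - resolventExp t r) * r ≤ t⁻¹ * y * r := by
    have := inv_pos.2 ht
    gcongr
    linarith
  linarith

theorem abs_resolventExp_sub_one_div_mul_sub_le {t r : ℝ} (ht : 0 < t)
    (hr : r ∈ Set.Icc (0 : ℝ) 1) :
    |(t⁻¹ * (resolventExp t r - 1) * r - (r - 1)) * r| ≤ t := by
  rcases hr.1.eq_or_lt with rfl | h0
  · simpa using ht.le
  set y := t * (r⁻¹ - 1) with hy
  have hy0 : 0 ≤ y := mul_nonneg ht.le (sub_nonneg.2 ((one_le_inv₀ h0).2 hr.2))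
  have h2 : 0 ≤ resolventExp t r - 1 + y := by
    rw [resolventExp_of_pos ht h0, ← hy]
    linarith [Real.add_one_le_exp (-y)]
  have h2' : resolventExp t r - 1 + y ≤ y ^ 2 := by
    rw [resolventExp_of_pos ht h0, ← hy, Real.exp_neg]
    have h3 : (Real.exp y)⁻¹ ≤ (1 + y)⁻¹ :=
      inv_anti₀ (by linarith) (by linarith [Real.add_one_le_exp y])
    have h4 : (1 + y)⁻¹ ≤ 1 - y + y ^ 2 := by
      rw [inv_le_iff_one_le_mul₀ (by linarith)]
      nlinarith [pow_nonneg hy0 3]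
    linarith
  have h3 : (t⁻¹ * (resolventExp t r - 1) * r - (r - 1)) * r =
      t⁻¹ * r ^ 2 * (resolventExp t r - 1 + y) := by
    rw [hy]; field_simp; ring
  have h5 : 0 ≤ t⁻¹ * r ^ 2 := mul_nonneg (inv_pos.2 ht).le (sq_nonneg _)
  rw [h3, abs_of_nonneg (mul_nonneg h5 h2)]
  calc t⁻¹ * r ^ 2 * (resolventExp t r - 1 + y) ≤ t⁻¹ * r ^ 2 * y ^ 2 := by gcongr
    _ = t * (1 - r) ^ 2 := by rw [hy]; field_simp
    _ ≤ t * 1 := by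
        gcongr
        nlinarith [hr.1, hr.2]
    _ = t := mul_one t

/-- Uniformly bounded operators that converge pointwise on a dense range converge pointwise. -/
theorem tendsto_apply_of_denseRange {ι H : Type*} [NormedAddCommGroup H] [NormedSpace ℂ H]
    {l : Filter ι} {T : ι → H →L[ℂ] H} {T₀ R : H →L[ℂ] H} {C : ℝ} (hR : DenseRange R)
    (hC : ∀ᶠ i in l, ‖T i‖ ≤ C) (h : ∀ x, Tendsto (fun i => T i (R x)) l (𝓝 (T₀ (R x)))) (u : H) :
    Tendsto (fun i => T i u) l (𝓝 (T₀ u)) := by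
  rw [Metric.tendsto_nhds]
  intro ε hε
  have hK : 0 < |C| + ‖T₀‖ + 1 := by positivity
  obtain ⟨x, hx⟩ := hR.exists_dist_lt u (show 0 < ε / 2 / (|C| + ‖T₀‖ + 1) by positivity)
  filter_upwards [hC, Metric.tendsto_nhds.1 (h x) (ε / 2) (half_pos hε)] with i hi hi'
  rw [dist_eq_norm] at hx hi' ⊢
  have h1 : T i u - T₀ u = (T i - T₀) (u - R x) + (T i (R x) - T₀ (R x)) := by
    simp only [map_sub, sub_apply]; abel
  have h2 : ‖T i - T₀‖ ≤ |C| + ‖T₀‖ :=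
    (norm_sub_le _ _).trans (add_le_add (hi.trans (le_abs_self C)) le_rfl)
  have h3 : ‖(T i - T₀) (u - R x)‖ ≤ ε / 2 := by
    refine ((T i - T₀).le_opNorm _).trans ?_
    calc ‖T i - T₀‖ * ‖u - R x‖ ≤ (|C| + ‖T₀‖ + 1) * (ε / 2 / (|C| + ‖T₀‖ + 1)) :=
          mul_le_mul (by linarith) hx.le (norm_nonneg _) hK.le
      _ = ε / 2 := by field_simp
  rw [h1]
  exact (norm_add_le _ _).trans_lt (by linarith)

section Semigroup

variable {H : Type*} [NormedAddCommGroup H] [InnerProductSpace ℂ H] [CompleteSpace H]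
  {A : H →ₗ.[ℂ] H} {R : H →L[ℂ] H}

open Classical in
/-- The semigroup `exp (t A)` as a function of the resolvent `R = (1 - A)⁻¹`. The case `t = 0` is
separate since the function that is `1` on `(0, 1]` and `0` at `0` is not continuous. -/
noncomputable def resolventSemigroup (R : H →L[ℂ] H) (t : ℝ≥0) : H →L[ℂ] H :=
  if t = 0 then ContinuousLinearMap.id ℂ H else cfc (resolventExp t) R

theorem resolventSemigroup_of_pos {t : ℝ≥0} (ht : 0 < t) :
    resolventSemigroup R t = cfc (resolventExp t) R := if_neg ht.ne'

theorem resolventSemigroup_zero : resolventSemigroup R 0 = ContinuousLinearMap.id ℂ H := if_pos rfl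

namespace LinearPMap.IsUnitResolvent

theorem norm_resolventSemigroup_le (hR : A.IsUnitResolvent R) {t : ℝ≥0} (ht : 0 < t) :
    ‖resolventSemigroup R t‖ ≤ 1 := by
  rw [resolventSemigroup_of_pos ht]
  refine norm_cfc_le zero_le_one fun r hr => ?_
  rw [Real.norm_eq_abs, abs_of_nonneg (resolventExp_nonneg _ _)]
  exact resolventExp_le_one ht (hR.spectrum_subset hr)

theorem cfc_differenceQuotient (hR : A.IsUnitResolvent R) {t : ℝ≥0} (ht : 0 < t) :
    cfc (fun r => (t : ℝ)⁻¹ * (resolventExp t r - 1) * r) R =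
      (t : ℝ)⁻¹ • ((resolventSemigroup R t - 1) * R) := by
  have hsa := hR.isSelfAdjoint
  have hc := continuous_resolventExp t
  rw [resolventSemigroup_of_pos ht, cfc_mul _ _ R (by fun_prop) (by fun_prop), cfc_id' ℝ R,
    cfc_const_mul _ _ R (by fun_prop), cfc_sub _ _ R (by fun_prop) (by fun_prop),
    cfc_const_one ℝ R, smul_mul_assoc]

theorem norm_differenceQuotient_le (hR : A.IsUnitResolvent R) {t : ℝ≥0} (ht : 0 < t) :
    ‖(t : ℝ)⁻¹ • ((resolventSemigroup R t - 1) * R)‖ ≤ 1 := by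
  rw [← hR.cfc_differenceQuotient ht]
  exact norm_cfc_le zero_le_one fun r hr =>
    abs_resolventExp_sub_one_div_mul_le ht (hR.spectrum_subset hr)

theorem norm_differenceQuotient_sub_mul_le (hR : A.IsUnitResolvent R) {t : ℝ≥0} (ht : 0 < t) :
    ‖((t : ℝ)⁻¹ • ((resolventSemigroup R t - 1) * R) - (R - 1)) * R‖ ≤ t := by
  have hsa := hR.isSelfAdjoint
  have hc := continuous_resolventExp t
  have h : cfc (fun r => ((t : ℝ)⁻¹ * (resolventExp t r - 1) * r - (r - 1)) * r) R =
      ((t : ℝ)⁻¹ • ((resolventSemigroup R t - 1) * R) - (R - 1)) * R := by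
    rw [cfc_mul _ _ R (by fun_prop) (by fun_prop), cfc_id' ℝ R,
      cfc_sub _ _ R (by fun_prop) (by fun_prop), hR.cfc_differenceQuotient ht,
      cfc_sub _ _ R (by fun_prop) (by fun_prop), cfc_id' ℝ R, cfc_const_one ℝ R]
  rw [← h]
  exact norm_cfc_le t.2 fun r hr =>
    abs_resolventExp_sub_one_div_mul_sub_le ht (hR.spectrum_subset hr)

theorem isC0Semigroup (hR : A.IsUnitResolvent R) : IsC0Semigroup (resolventSemigroup R) where
  map_zero := resolventSemigroup_zero
  map_add s t := by
    rcases eq_zero_or_pos s with rfl | hs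
    · rw [zero_add, resolventSemigroup_zero, ContinuousLinearMap.id_comp]
    rcases eq_zero_or_pos t with rfl | ht
    · rw [add_zero, resolventSemigroup_zero, ContinuousLinearMap.comp_id]
    have hsa := hR.isSelfAdjoint
    have hc := continuous_resolventExp t
    have hc' := continuous_resolventExp s
    rw [resolventSemigroup_of_pos hs, resolventSemigroup_of_pos ht,
      resolventSemigroup_of_pos (add_pos hs ht), ← ContinuousLinearMap.mul_def,
      ← cfc_mul _ _ R (by fun_prop) (by fun_prop)]
    refine cfc_congr fun r hr => ?_
    rw [NNReal.coe_add]
    exact resolventExp_add hs ht (hR.spectrum_subset hr).1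
  tendsto_zero u := by
    refine tendsto_apply_of_denseRange (T₀ := 1) (C := 1) hR.denseRange ?_ (fun x => ?_) u
    · refine Eventually.of_forall fun t => ?_
      rcases eq_zero_or_pos t with rfl | ht
      · rw [resolventSemigroup_zero]
        exact ContinuousLinearMap.norm_id_le
      · exact hR.norm_resolventSemigroup_le ht
    · rw [tendsto_iff_norm_sub_tendsto_zero]
      refine squeeze_zero (g := fun t : ℝ≥0 => (t : ℝ) * ‖x‖) (fun _ => norm_nonneg _)
        (fun t => ?_) ?_
      · rcases eq_zero_or_pos t with rfl | ht
        · simp [resolventSemigroup_zero]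
        · have h1 := ((t : ℝ)⁻¹ • ((resolventSemigroup R t - 1) * R)).le_opNorm x
          have h2 := h1.trans
            (mul_le_mul_of_nonneg_right (hR.norm_differenceQuotient_le ht) (norm_nonneg x))
          have ht' : (0 : ℝ) < t := ht
          rw [_root_.smul_apply, norm_smul, norm_inv, Real.norm_of_nonneg ht'.le,
            inv_mul_le_iff₀ ht', one_mul] at h2
          exact h2
      · have : Tendsto (fun t : ℝ≥0 => (t : ℝ) * ‖x‖) (𝓝 0) (𝓝 (((0 : ℝ≥0) : ℝ) * ‖x‖)) :=
          ((NNReal.continuous_coe.tendsto 0).mul_const _)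
        simpa using this

theorem hasGenerator (hR : A.IsUnitResolvent R) : HasGenerator (resolventSemigroup R) A := by
  have hsm : ∀ (t : ℝ≥0) (x : H), ((((t : ℝ) : ℂ))⁻¹ • x : H) = (t : ℝ)⁻¹ • x := fun t x => by
    rw [← Complex.ofReal_inv, Complex.coe_smul]
  have key : ∀ x, Tendsto
      (fun t : ℝ≥0 => (((t : ℝ) : ℂ))⁻¹ • (resolventSemigroup R t (R x) - R x)) (𝓝[>] 0)
      (𝓝 ((R - 1) x)) := by
    intro x
    simp_rw [hsm]
    refine tendsto_apply_of_denseRange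
      (T := fun t : ℝ≥0 => (t : ℝ)⁻¹ • ((resolventSemigroup R t - 1) * R))
      (T₀ := R - 1) (C := 1) hR.denseRange ?_ (fun x => ?_) x
    · filter_upwards [self_mem_nhdsWithin] with t ht
      exact hR.norm_differenceQuotient_le ht
    · rw [tendsto_iff_norm_sub_tendsto_zero]
      refine squeeze_zero' (g := fun t : ℝ≥0 => (t : ℝ) * ‖x‖)
        (Eventually.of_forall fun _ => norm_nonneg _) ?_ ?_
      · filter_upwards [self_mem_nhdsWithin] with t ht
        have h1 := (((t : ℝ)⁻¹ • ((resolventSemigroup R t - 1) * R) - (R - 1)) * R).le_opNorm x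
        exact h1.trans
          (mul_le_mul_of_nonneg_right (hR.norm_differenceQuotient_sub_mul_le ht) (norm_nonneg x))
      · have : Tendsto (fun t : ℝ≥0 => (t : ℝ) * ‖x‖) (𝓝 0) (𝓝 (((0 : ℝ≥0) : ℝ) * ‖x‖)) :=
          ((NNReal.continuous_coe.tendsto 0).mul_const _)
        simpa using this.mono_left nhdsWithin_le_nhds
  intro u w
  constructor
  · intro h
    have h1 := (hR.mem_graph u w).1 h
    have h2 := key (u - w)
    rw [h1] at h2
    simpa [h1] using h2
  · -- `R` commutes with the semigroup, so applying it to the limit identifies `w`.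
    intro h
    have hcomm : ∀ t : ℝ≥0, 0 < t → ∀ x, R (resolventSemigroup R t x) =
        resolventSemigroup R t (R x) := fun t ht x => by
      have hsa := hR.isSelfAdjoint
      have : Commute (cfc (resolventExp t) R) R := by
        have := cfc_commute_cfc (resolventExp t) (fun r : ℝ => r) R
        rwa [cfc_id' ℝ R] at this
      rw [resolventSemigroup_of_pos ht]
      exact (congrArg (fun T : H →L[ℂ] H => T x) this.eq).symm
    have h1 := (R.continuous.tendsto w).comp h
    have h2 := tendsto_nhds_unique (h1.congr' ?_) (key u)
    · rw [hR.mem_graph, _root_.map_sub, h2]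
      simp
    · filter_upwards [self_mem_nhdsWithin] with t ht
      simp [hcomm t ht]

end LinearPMap.IsUnitResolvent

end Semigroup

/-! ### Uniqueness of the semigroup with a given generator -/

section Uniqueness

variable {H : Type*} [NormedAddCommGroup H] [NormedSpace ℂ H] {P : ℝ≥0 → H →L[ℂ] H}

theorem IsC0Semigroup.exists_norm_le_near_zero [CompleteSpace H] (hP : IsC0Semigroup P) :
    ∃ δ > 0, ∃ M, ∀ t ≤ δ, ‖P t‖ ≤ M := by
  by_contra! h
  choose! s hs hs' using fun k : ℕ => h (k + 1 : ℝ≥0)⁻¹ (by positivity) k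
  have hlim : Tendsto s atTop (𝓝 0) := by
    refine tendsto_of_tendsto_of_tendsto_of_le_of_le tendsto_const_nhds ?_ (fun _ => zero_le) hs
    exact tendsto_inv_atTop_nhds_zero_nat.comp (tendsto_add_atTop_nat 1) |>.congr fun k => by simp
  obtain ⟨C, hC⟩ := banach_steinhaus (g := fun k => P (s k)) fun x => by
    obtain ⟨C, hC⟩ := ((hP.tendsto_zero x).comp hlim).norm.bddAbove_range
    exact ⟨C, fun k => hC ⟨k, rfl⟩⟩
  obtain ⟨k, hk⟩ := exists_nat_gt C
  linarith [hC k, hs' k]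

theorem IsC0Semigroup.exists_norm_le [CompleteSpace H] (hP : IsC0Semigroup P) (T : ℝ≥0) :
    ∃ M, ∀ t ≤ T, ‖P t‖ ≤ M := by
  obtain ⟨δ, hδ, M, hM⟩ := hP.exists_norm_le_near_zero
  have key : ∀ k : ℕ, ∃ M', ∀ t ≤ k * δ, ‖P t‖ ≤ M' := by
    intro k
    induction k with
    | zero => exact ⟨M, fun t ht => hM t (ht.trans (by simp))⟩
    | succ k ih =>
      obtain ⟨M', hM'⟩ := ih
      refine ⟨max M' (M' * M), fun t ht => ?_⟩
      rcases le_total t (k * δ) with h | h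
      · exact (hM' t h).trans (le_max_left _ _)
      · obtain ⟨s, rfl⟩ := exists_add_of_le h
        have hs : s ≤ δ := by
          have : (k : ℝ≥0) * δ + s ≤ k * δ + δ := by
            refine ht.trans (le_of_eq ?_); push_cast; ring
          exact le_of_add_le_add_left this
        rw [hP.map_add]
        refine ((ContinuousLinearMap.opNorm_comp_le _ _).trans ?_).trans (le_max_right _ _)
        exact mul_le_mul (hM' _ le_rfl) (hM s hs) (norm_nonneg _)
          ((norm_nonneg _).trans (hM' _ le_rfl))
  obtain ⟨k, hk⟩ := exists_nat_ge (T / δ)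
  obtain ⟨M', hM'⟩ := key k
  exact ⟨M', fun t ht => hM' t (ht.trans ((div_le_iff₀ hδ).1 hk))⟩

theorem IsC0Semigroup.continuous_apply [CompleteSpace H] (hP : IsC0Semigroup P) (u : H) :
    Continuous fun t => P t u := by
  refine continuous_iff_continuousAt.2 fun t => ?_
  obtain ⟨M, hM⟩ := hP.exists_norm_le (t + 1)
  have hM0 : 0 ≤ M := (norm_nonneg _).trans (hM 0 zero_le)
  have hle : ∀ a b : ℝ≥0, a ≤ t + 1 → a ≤ b → ‖P b u - P a u‖ ≤ M * ‖P (b - a) u - u‖ := by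
    intro a b ha hab
    have h1 : P b u - P a u = P a (P (b - a) u - u) := by
      rw [map_sub, ← ContinuousLinearMap.comp_apply, ← hP.map_add, add_tsub_cancel_of_le hab]
    rw [h1]
    exact ((P a).le_opNorm _).trans (mul_le_mul_of_nonneg_right (hM a ha) (norm_nonneg _))
  rw [ContinuousAt, tendsto_iff_norm_sub_tendsto_zero]
  refine squeeze_zero' (g := fun s => M * ‖P (s - t) u - u‖ + M * ‖P (t - s) u - u‖)
    (Eventually.of_forall fun _ => norm_nonneg _) ?_ ?_
  · filter_upwards with s
    rcases le_total t s with h | h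
    · exact (hle t s le_self_add h).trans (le_add_of_nonneg_right (by positivity))
    · rw [norm_sub_rev]
      exact (hle s t (h.trans le_self_add) h).trans (le_add_of_nonneg_left (by positivity))
  · have h1 : Tendsto (fun s : ℝ≥0 => s - t) (𝓝 t) (𝓝 0) := by
      have : Continuous fun s : ℝ≥0 => s - t := by fun_prop
      simpa using this.tendsto t
    have h2 : Tendsto (fun s : ℝ≥0 => t - s) (𝓝 t) (𝓝 0) := by
      have : Continuous fun s : ℝ≥0 => t - s := by fun_prop
      simpa using this.tendsto t
    have h3 := (((hP.tendsto_zero u).sub_const u).norm.const_mul M)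
    simpa using (h3.comp h1).add (h3.comp h2)

theorem HasGenerator.apply_mem_graph {A : H →ₗ.[ℂ] H} (hA : HasGenerator P A)
    (hP : IsC0Semigroup P) {u w : H} (h : (u, w) ∈ A.graph) (t : ℝ≥0) :
    (P t u, P t w) ∈ A.graph := by
  rw [hA]
  refine (((P t).continuous.tendsto w).comp ((hA u w).1 h)).congr fun s => ?_
  simp only [Function.comp_apply, map_smul, map_sub]
  rw [← ContinuousLinearMap.comp_apply, ← ContinuousLinearMap.comp_apply, ← hP.map_add,
    ← hP.map_add, add_comm]

theorem HasGenerator.hasDerivWithinAt {A : H →ₗ.[ℂ] H} (hA : HasGenerator P A)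
    (hP : IsC0Semigroup P) {u w : H} (h : (u, w) ∈ A.graph) {s : ℝ} (hs : 0 ≤ s) :
    HasDerivWithinAt (fun s : ℝ => P s.toNNReal u) (P s.toNNReal w) (Set.Ici s) s := by
  rw [hasDerivWithinAt_iff_tendsto_slope, Set.Ici_sdiff_left]
  have hlim : Tendsto (fun y : ℝ => (y - s).toNNReal) (𝓝[>] s) (𝓝[>] 0) := by
    refine tendsto_nhdsWithin_iff.2 ⟨?_, ?_⟩
    · have : Continuous fun y : ℝ => (y - s).toNNReal := by fun_prop
      have h0 := this.tendsto s
      simp only [sub_self, Real.toNNReal_zero] at h0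
      exact h0.mono_left nhdsWithin_le_nhds
    · filter_upwards [self_mem_nhdsWithin] with y hy
      exact Real.toNNReal_pos.2 (sub_pos.2 hy)
  have h1 := (((P s.toNNReal).continuous.tendsto w).comp ((hA u w).1 h)).comp hlim
  refine h1.congr' ?_
  filter_upwards [self_mem_nhdsWithin] with y hy
  have hys : 0 ≤ y - s := (sub_pos.2 hy).le
  have h2 : y.toNNReal = s.toNNReal + (y - s).toNNReal := by
    rw [← Real.toNNReal_add hs hys, add_sub_cancel]
  simp only [Function.comp_apply, map_smul, map_sub, slope, vsub_eq_sub]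
  rw [h2, hP.map_add, ContinuousLinearMap.comp_apply, Real.coe_toNNReal _ hys,
    ← Complex.ofReal_inv, Complex.coe_smul]

/-- For a dissipative generator `A` and `u` in its domain, the squared norm of
`P t u - Q t u` has right derivative at most `0`, so the two orbits agree. -/
theorem IsC0Semigroup.eq_of_hasGenerator {H : Type*} [NormedAddCommGroup H]
    [InnerProductSpace ℂ H] [CompleteSpace H] {P Q : ℝ≥0 → H →L[ℂ] H} {A : H →ₗ.[ℂ] H}
    (hP : IsC0Semigroup P) (hQ : IsC0Semigroup Q) (hPA : HasGenerator P A)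
    (hQA : HasGenerator Q A) (hneg : ∀ p ∈ A.graph, (inner ℂ p.1 p.2).re ≤ 0)
    (hdense : Dense (A.domain : Set H)) : P = Q := by
  have key : ∀ p ∈ A.graph, ∀ t, P t p.1 = Q t p.1 := by
    rintro ⟨u, w⟩ hp t
    set φ : ℝ → H := fun s => P s.toNNReal u - Q s.toNNReal u with hφ
    set ψ : ℝ → H := fun s => P s.toNNReal w - Q s.toNNReal w with hψ
    have hderiv : ∀ s, 0 ≤ s → HasDerivWithinAt φ (ψ s) (Set.Ici s) s := fun s hs =>
      (hPA.hasDerivWithinAt hP hp hs).sub (hQA.hasDerivWithinAt hQ hp hs)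
    have hcont : Continuous φ :=
      ((hP.continuous_apply u).comp continuous_real_toNNReal).sub
        ((hQ.continuous_apply u).comp continuous_real_toNNReal)
    have hmem : ∀ s, (φ s, ψ s) ∈ A.graph := fun s =>
      A.graph.sub_mem (hPA.apply_mem_graph hP hp _) (hQA.apply_mem_graph hQ hp _)
    have hsq : ∀ s, 0 ≤ s → HasDerivWithinAt (fun s => (inner ℂ (φ s) (φ s)).re)
        (2 * (inner ℂ (φ s) (ψ s)).re) (Set.Ici s) s := fun s hs => by
      have h1 := (hderiv s hs).inner ℂ (hderiv s hs)
      have h2 := Complex.reCLM.hasFDerivAt.comp_hasDerivWithinAt s h1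
      refine h2.congr_deriv ?_
      rw [Complex.reCLM_apply, Complex.add_re, ← inner_conj_symm (ψ s), Complex.conj_re]
      ring
    have hle := image_le_of_deriv_right_le_deriv_boundary (a := 0) (b := t)
      (f := fun s => (inner ℂ (φ s) (φ s)).re) (B := fun _ => 0) (B' := fun _ => 0)
      (f' := fun s => 2 * (inner ℂ (φ s) (ψ s)).re)
      (by fun_prop) (fun s hs => hsq s hs.1)
      (by simp [hφ, hP.map_zero, hQ.map_zero]) continuousOn_const
      (fun s _ => hasDerivWithinAt_const _ _ _)
      (fun s _ => by linarith [hneg _ (hmem s)]) (Set.right_mem_Icc.2 t.2)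
    have h0 : φ t = 0 := by
      rw [← norm_le_zero_iff]
      have h1 : ‖φ t‖ ^ 2 ≤ 0 := (norm_sq_eq_re_inner (𝕜 := ℂ) (φ t)).trans_le hle
      exact (pow_eq_zero_iff two_ne_zero).1 (le_antisymm h1 (sq_nonneg _)) |>.le
    simpa [hφ, sub_eq_zero] using h0
  funext t
  refine ContinuousLinearMap.ext fun u => ?_
  refine congrFun (Continuous.ext_on hdense (P t).continuous (Q t).continuous fun x hx => ?_) u
  exact key _ (A.mem_graph ⟨x, hx⟩) t

end Uniqueness

theorem semigroupGeneratedBy_eq_resolventSemigroup {H : Type*} [NormedAddCommGroup H]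
    [InnerProductSpace ℂ H] [CompleteSpace H] {A : H →ₗ.[ℂ] H} {R : H →L[ℂ] H}
    (hA : A.IsNonposSelfAdjoint) (hR : A.IsUnitResolvent R) :
    semigroupGeneratedBy A = resolventSemigroup R := by
  have h : ∃ Q : ℝ≥0 → H →L[ℂ] H, IsC0Semigroup Q ∧ HasGenerator Q A :=
    ⟨_, hR.isC0Semigroup, hR.hasGenerator⟩
  rw [semigroupGeneratedBy, dif_pos h]
  refine h.choose_spec.1.eq_of_hasGenerator hR.isC0Semigroup h.choose_spec.2 hR.hasGenerator
    hA.nonpos (hR.denseRange.mono ?_)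
  rintro _ ⟨x, rfl⟩
  exact LinearPMap.mem_domain_of_mem_graph (hR.range_mem_graph x)

/-! ### Spectrum of the semigroup of an operator that is similar to its positive multiples -/

theorem resolventExp_ne {t r r₀ : ℝ} (ht : 0 < t) (h₀ : 0 < r₀) (hr : 0 ≤ r) (hne : r ≠ r₀) :
    resolventExp t r ≠ resolventExp t r₀ := by
  rcases hr.eq_or_lt with rfl | h
  · rw [resolventExp_zero, resolventExp_of_pos ht h₀]
    exact (Real.exp_pos _).ne
  · rw [resolventExp_of_pos ht h₀, resolventExp_of_pos ht h]
    intro he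
    have h1 := mul_left_cancel₀ ht.ne' (neg_injective (Real.exp_injective he))
    exact hne (inv_injective (sub_left_injective h1))

theorem deriv_resolventExp_ne_zero {t r₀ : ℝ} (ht : 0 < t) (h₀ : 0 < r₀) :
    deriv (resolventExp t) r₀ ≠ 0 := by
  have h1 : resolventExp t =ᶠ[𝓝 r₀] fun r => Real.exp (-(t * (r⁻¹ - 1))) := by
    filter_upwards [lt_mem_nhds h₀] with r hr
    exact resolventExp_of_pos ht hr
  have h2 : HasDerivAt (fun r : ℝ => Real.exp (-(t * (r⁻¹ - 1))))
      (Real.exp (-(t * (r₀⁻¹ - 1))) * -(t * -(r₀ ^ 2)⁻¹)) r₀ :=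
    ((((hasDerivAt_inv h₀.ne').sub_const 1).const_mul t).neg).exp
  rw [h1.deriv_eq, h2.deriv]
  have h3 : 0 < (r₀ ^ 2)⁻¹ := by positivity
  have : 0 < -(t * -(r₀ ^ 2)⁻¹) := by nlinarith
  exact (mul_pos (Real.exp_pos _) this).ne'

section Spectrum

variable {H : Type*} [NormedAddCommGroup H] [InnerProductSpace ℂ H]

/-- Nonzero pairwise orthogonal vectors in a separable space form a countable family. -/
theorem countable_of_pairwise_inner_eq_zero [TopologicalSpace.SeparableSpace H] {ι : Type*}
    {v : ι → H} (hv : ∀ i, v i ≠ 0) (h : Pairwise fun i j => inner ℂ (v i) (v j) = 0) :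
    Countable ι := by
  let e : ι → H := fun i => ((‖v i‖⁻¹ : ℝ) : ℂ) • v i
  have he : ∀ i, ‖e i‖ = 1 := fun i => by
    have : ‖v i‖ ≠ 0 := norm_ne_zero_iff.2 (hv i)
    simp [e, norm_smul, this]
  refine Pairwise.countable_of_isOpen_disjoint (s := fun i => Metric.ball (e i) (1 / 2))
    (fun i j hij => Metric.ball_disjoint_ball ?_) (fun i => Metric.isOpen_ball)
    (fun i => Metric.nonempty_ball.2 (by norm_num))
  have h0 : inner ℂ (e i) (e j) = 0 := by simp [e, h hij]
  have h1 := norm_sub_sq (𝕜 := ℂ) (e i) (e j)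
  rw [h0, he, he, map_zero] at h1
  rw [dist_eq_norm]
  nlinarith [norm_nonneg (e i - e j)]

variable {A : H →ₗ.[ℂ] H}

/-- `A` is similar to `c A` for every `c > 0`: some bounded invertible `S` maps the graph of `A`
into the graph of `c⁻¹ A`. -/
def LinearPMap.IsSimilarToMultiples (A : H →ₗ.[ℂ] H) : Prop :=
  ∀ c : ℝ, 0 < c → ∃ S : H ≃L[ℂ] H, ∀ p ∈ A.graph, (S p.1, (c : ℂ) • S p.2) ∈ A.graph

/-- An eigenvector in the kernel is excluded by hypothesis; any other one would yield, by
similarity, eigenvectors for uncountably many eigenvalues, and these are pairwise orthogonal. -/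
theorem LinearPMap.IsNonposSelfAdjoint.eq_zero_of_mem_graph_smul
    [TopologicalSpace.SeparableSpace H]
    (hA : A.IsNonposSelfAdjoint) (hker : ∀ u, (u, 0) ∈ A.graph → u = 0)
    (hS : A.IsSimilarToMultiples) {u : H} {l : ℝ} (h : (u, (l : ℂ) • u) ∈ A.graph) : u = 0 := by
  by_contra hu
  have hl : l ≠ 0 := by
    rintro rfl
    exact hu (hker u (by simpa using h))
  choose S hSg using fun c : Set.Ioi (0 : ℝ) => hS c.1 c.2
  have hmem : ∀ c : Set.Ioi (0 : ℝ), (S c u, ((c * l : ℝ) : ℂ) • S c u) ∈ A.graph := fun c => by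
    have := hSg c _ h
    rwa [_root_.map_smul, smul_smul, ← Complex.ofReal_mul] at this
  have hcount : Countable (Set.Ioi (0 : ℝ)) := by
    refine countable_of_pairwise_inner_eq_zero (v := fun c => S c u)
      (fun c => (map_ne_zero_iff (S c) (S c).injective).2 hu) fun c d hcd => ?_
    have h1 := hA.symm _ (hmem c) _ (hmem d)
    rw [inner_smul_left, inner_smul_right, Complex.conj_ofReal, ← sub_eq_zero, ← sub_mul,
      mul_eq_zero] at h1
    refine h1.resolve_left fun h2 => hcd ?_
    rw [← Complex.ofReal_sub, Complex.ofReal_eq_zero, ← sub_mul] at h2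
    exact Subtype.ext (sub_eq_zero.1 ((mul_eq_zero.1 h2).resolve_right hl))
  have := Cardinal.mk_le_aleph0_iff.2 hcount
  rw [Cardinal.mk_Ioi_real] at this
  exact this.not_gt Cardinal.aleph0_lt_continuum

variable [CompleteSpace H] {R : H →L[ℂ] H}

namespace LinearPMap.IsUnitResolvent

theorem eq_zero_of_apply_eq_smul [TopologicalSpace.SeparableSpace H]
    (hR : A.IsUnitResolvent R) (hA : A.IsNonposSelfAdjoint)
    (hker : ∀ u, (u, 0) ∈ A.graph → u = 0) (hS : A.IsSimilarToMultiples) {u : H} {r : ℝ}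
    (hr : 0 < r) (h : R u = (r : ℂ) • u) : u = 0 := by
  refine hA.eq_zero_of_mem_graph_smul hker hS (l := 1 - r⁻¹) ?_
  have hr' : (r : ℂ) ≠ 0 := Complex.ofReal_ne_zero.2 hr.ne'
  have h1 : u - ((1 - r⁻¹ : ℝ) : ℂ) • u = (r : ℂ)⁻¹ • u := by
    push_cast
    rw [sub_smul, one_smul, sub_sub_cancel]
  rw [hR.mem_graph, h1, _root_.map_smul, h, smul_smul, inv_mul_cancel₀ hr', one_smul]

/-- If `S` intertwines `A` and `c A` then `S R S⁻¹ = φ(R)` with `φ r = c r / (1 - (1 - c) r)`. -/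
theorem image_spectrum_eq (hR : A.IsUnitResolvent R) (hS : A.IsSimilarToMultiples) {c : ℝ}
    (hc : 0 < c) :
    (fun r : ℝ => c * r / (1 - (1 - c) * r)) '' spectrum ℝ R = spectrum ℝ R := by
  have hsa := hR.isSelfAdjoint
  obtain ⟨S, hSg⟩ := hS c hc
  have hden : ∀ r ∈ spectrum ℝ R, 1 - (1 - c) * r ≠ 0 := fun r hr => by
    have h := hR.spectrum_subset hr
    rcases h.2.eq_or_lt with h1 | h1
    · rw [h1]; linarith
    · have : 0 ≤ c * r := mul_nonneg hc.le h.1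
      linarith
  have hcont : ContinuousOn (fun r : ℝ => c * r / (1 - (1 - c) * r)) (spectrum ℝ R) :=
    ContinuousOn.div (by fun_prop) (by fun_prop) hden
  let U : (H →L[ℂ] H)ˣ := S.toUnit
  set R' : H →L[ℂ] H := U * R * (U⁻¹ : (H →L[ℂ] H)ˣ) with hR'
  have hint : ∀ x, R ((1 - c : ℂ) • S (R x) + (c : ℂ) • S x) = S (R x) := by
    intro x
    have h1 := (hR.mem_graph _ _).1 (hSg _ (hR.range_mem_graph x))
    simp only at h1
    rw [← h1]
    congr 1
    rw [h1, _root_.map_sub, smul_sub, sub_smul, one_smul]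
    abel
  have hmul : (1 - (1 - c) • R) * R' = c • R := by
    refine ContinuousLinearMap.ext fun y => ?_
    have h1 := hint (S.symm y)
    have h2 : R' y = S (R (S.symm y)) := rfl
    rw [ContinuousLinearEquiv.apply_symm_apply, _root_.map_add, _root_.map_smul, _root_.map_smul,
      ← h2] at h1
    have h3 : (1 - (1 - c) • R) (R' y) = R' y - ((1 - c : ℝ) : ℂ) • R (R' y) := by
      rw [Complex.coe_smul]; rfl
    have h4 : (c • R) y = (c : ℂ) • R y := by rw [Complex.coe_smul]; rfl
    rw [mul_apply_eq_comp, h3, h4, sub_eq_iff_eq_add', Complex.ofReal_sub,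
      Complex.ofReal_one]
    exact h1.symm
  have h1 : cfc (fun r : ℝ => 1 - (1 - c) * r) R = 1 - (1 - c) • R := by
    rw [cfc_sub _ _ R (by fun_prop) (by fun_prop), cfc_const_one ℝ R,
      cfc_const_mul _ _ R (by fun_prop), cfc_id' ℝ R]
  have hcfc : (1 - (1 - c) • R) * cfc (fun r : ℝ => c * r / (1 - (1 - c) * r)) R = c • R := by
    have h2 : cfc (fun r : ℝ => c * r) R = c • R := by
      rw [cfc_const_mul _ _ R (by fun_prop), cfc_id' ℝ R]
    rw [← h1, ← h2, ← cfc_mul _ _ R (by fun_prop) hcont]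
    exact cfc_congr fun r hr => mul_div_cancel₀ _ (hden r hr)
  have hunit : IsUnit (1 - (1 - c) • R) := by
    rw [← h1, isUnit_cfc_iff _ R (by fun_prop)]
    exact hden
  have heq : cfc (fun r : ℝ => c * r / (1 - (1 - c) * r)) R = R' :=
    hunit.mul_left_cancel (hcfc.trans hmul.symm)
  rw [← cfc_map_spectrum _ R hsa hcont, heq, hR', spectrum.units_conjugate]

theorem spectrum_eq [Nontrivial H] (hR : A.IsUnitResolvent R)
    (hker : ∀ u, (u, 0) ∈ A.graph → u = 0) (hS : A.IsSimilarToMultiples) :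
    spectrum ℝ R = Set.Icc 0 1 := by
  have hsa := hR.isSelfAdjoint
  refine Set.Subset.antisymm hR.spectrum_subset ?_
  obtain ⟨r, hr, hr0, hr1⟩ : ∃ r ∈ spectrum ℝ R, 0 < r ∧ r < 1 := by
    by_contra! hno
    -- Otherwise `R` is an injective projection, so `R = 1` and `A = 0`.
    have hsq : R * R = R := by
      have h1 : cfc (fun r : ℝ => r * r) R = cfc (fun r : ℝ => r) R := by
        refine cfc_congr fun r hr => ?_
        rcases (hR.spectrum_subset hr).1.eq_or_lt with h0 | h0
        · simp [← h0]
        · have : r = 1 := le_antisymm (hR.spectrum_subset hr).2 (hno r hr h0)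
          simp [this]
      rwa [cfc_mul _ _ R, cfc_id' ℝ R] at h1
    obtain ⟨u, hu⟩ := exists_ne (0 : H)
    refine hu (hker u ((hR.mem_graph u 0).2 ?_))
    have h2 : R (R u - u) = 0 := by
      rw [_root_.map_sub, ← mul_apply_eq_comp, hsq, sub_self]
    rw [sub_zero]
    exact sub_eq_zero.1 (hR.eq_zero_of_apply_eq_zero h2)
  have hIoo : Set.Ioo (0 : ℝ) 1 ⊆ spectrum ℝ R := by
    intro q hq
    have h1 : 0 < 1 - q := sub_pos.2 hq.2
    have h2 : 0 < 1 - r := sub_pos.2 hr1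
    have hc : 0 < q * (1 - r) / (r * (1 - q)) := div_pos (mul_pos hq.1 h2) (mul_pos hr0 h1)
    rw [← hR.image_spectrum_eq hS hc]
    refine ⟨r, hr, ?_⟩
    have h3 : 1 - (1 - q * (1 - r) / (r * (1 - q))) * r = (1 - r) / (1 - q) := by
      field_simp; ring
    simp only [h3]
    field_simp
  rw [← closure_Ioo zero_ne_one]
  exact closure_minimal hIoo (spectrum.isClosed R)

theorem isSelfAdjoint_resolventSemigroup {t : ℝ≥0} (ht : 0 < t) :
    IsSelfAdjoint (resolventSemigroup R t) := by
  rw [resolventSemigroup_of_pos ht]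
  exact cfc_predicate _ _

theorem spectrum_resolventSemigroup [Nontrivial H] (hR : A.IsUnitResolvent R)
    (hker : ∀ u, (u, 0) ∈ A.graph → u = 0) (hS : A.IsSimilarToMultiples) {t : ℝ≥0} (ht : 0 < t) :
    spectrum ℝ (resolventSemigroup R t) = Set.Icc 0 1 := by
  have hc := continuous_resolventExp t
  rw [resolventSemigroup_of_pos ht, cfc_map_spectrum _ R hR.isSelfAdjoint (by fun_prop),
    hR.spectrum_eq hker hS]
  refine Set.Subset.antisymm ?_ ?_
  · rintro _ ⟨r, hr, rfl⟩
    exact ⟨resolventExp_nonneg _ _, resolventExp_le_one ht hr⟩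
  · have := intermediate_value_Icc zero_le_one hc.continuousOn
    rwa [resolventExp_zero, resolventExp_one (NNReal.coe_pos.2 ht)] at this

theorem eq_zero_of_resolventSemigroup_eq_zero (hR : A.IsUnitResolvent R) {t : ℝ≥0} (ht : 0 < t)
    {u : H} (h : resolventSemigroup R t u = 0) : u = 0 := by
  have hhalf : ∀ s : ℝ≥0, 0 < s → resolventSemigroup R s u = 0 →
      resolventSemigroup R (s / 2) u = 0 := by
    intro s hs h0
    have h1 := (isSelfAdjoint_resolventSemigroup (R := R) (half_pos hs)).isSymmetric
      (resolventSemigroup R (s / 2) u) u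
    have h2 : resolventSemigroup R (s / 2) (resolventSemigroup R (s / 2) u) = 0 := by
      rw [← ContinuousLinearMap.comp_apply, ← hR.isC0Semigroup.map_add, add_halves, h0]
    simp only [ContinuousLinearMap.coe_coe, h2, inner_zero_left] at h1
    exact inner_self_eq_zero.1 h1.symm
  have hk : ∀ k : ℕ, resolventSemigroup R (t / 2 ^ k) u = 0 := by
    intro k
    induction k with
    | zero => simpa using h
    | succ k ih =>
      rw [pow_succ, ← div_div]
      exact hhalf _ (by positivity) ih
  have hlim : Tendsto (fun k : ℕ => t / 2 ^ k) atTop (𝓝 0) := by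
    have := (NNReal.tendsto_pow_atTop_nhds_zero_of_lt_one (r := (2 : ℝ≥0)⁻¹)
      (inv_lt_one_of_one_lt₀ one_lt_two)).const_mul t
    simpa [div_eq_mul_inv, inv_pow] using this
  have h1 := (hR.isC0Semigroup.tendsto_zero u).comp hlim
  refine tendsto_nhds_unique h1 (tendsto_const_nhds.congr fun k => ?_)
  exact (hk k).symm

theorem eq_zero_of_resolventSemigroup_eq_smul [TopologicalSpace.SeparableSpace H]
    (hR : A.IsUnitResolvent R) (hA : A.IsNonposSelfAdjoint)
    (hker : ∀ u, (u, 0) ∈ A.graph → u = 0) (hS : A.IsSimilarToMultiples)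
    {t : ℝ≥0} (ht : 0 < t) {z : ℝ} (hz : z ∈ Set.Icc (0 : ℝ) 1) {u : H}
    (h : resolventSemigroup R t u = (z : ℂ) • u) : u = 0 := by
  have ht' : (0 : ℝ) < t := ht
  have hsa := hR.isSelfAdjoint
  have hc := continuous_resolventExp t
  obtain ⟨r, hr, rfl⟩ : z ∈ resolventExp t '' Set.Icc 0 1 := by
    have := intermediate_value_Icc zero_le_one (hc.continuousOn (s := Set.Icc 0 1))
    rw [resolventExp_zero, resolventExp_one ht'] at this
    exact this hz
  rcases hr.1.eq_or_lt with rfl | hr0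
  · rw [resolventExp_zero, Complex.ofReal_zero, zero_smul] at h
    exact hR.eq_zero_of_resolventSemigroup_eq_zero ht h
  -- `f(R) - f(r) = h(R) (R - r)` where the difference quotient `h` of `f` at `r` vanishes nowhere.
  refine hR.eq_zero_of_apply_eq_smul hA hker hS hr0 ?_
  have hd : Continuous (dslope (resolventExp t) r) := by
    rw [← continuousOn_univ, continuousOn_dslope univ_mem]
    exact ⟨hc.continuousOn, (contDiff_resolventExp t).differentiable one_ne_zero r⟩
  have hunit : IsUnit (cfc (dslope (resolventExp t) r) R) := by
    rw [isUnit_cfc_iff _ R (by fun_prop)]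
    intro s hs
    rcases eq_or_ne s r with rfl | hne
    · rw [dslope_same]
      exact deriv_resolventExp_ne_zero ht' hr0
    · rw [dslope_of_ne _ hne, slope_def_field]
      exact div_ne_zero
        (sub_ne_zero.2 (resolventExp_ne ht' hr0 (hR.spectrum_subset hs).1 hne)) (sub_ne_zero.2 hne)
  have hfac : cfc (dslope (resolventExp t) r) R * (R - algebraMap ℝ _ r) =
      resolventSemigroup R t - algebraMap ℝ _ (resolventExp t r) := by
    have h1 : cfc (fun s : ℝ => s - r) R = R - algebraMap ℝ _ r := by
      rw [cfc_sub _ _ R (by fun_prop) (by fun_prop), cfc_id' ℝ R, cfc_const r R]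
    have h2 : cfc (fun s : ℝ => resolventExp t s - resolventExp t r) R =
        resolventSemigroup R t - algebraMap ℝ _ (resolventExp t r) := by
      rw [cfc_sub _ _ R (by fun_prop) (by fun_prop), cfc_const _ R, resolventSemigroup_of_pos ht]
    rw [← h1, ← h2, ← cfc_mul _ _ R (by fun_prop) (by fun_prop)]
    refine cfc_congr fun s _ => ?_
    have := sub_smul_dslope (resolventExp t) r s
    rw [smul_eq_mul, mul_comm] at this
    exact this
  obtain ⟨V, hV⟩ := hunit
  have h0 : (cfc (dslope (resolventExp t) r) R) ((R - algebraMap ℝ (H →L[ℂ] H) r) u) = 0 := by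
    rw [← mul_apply_eq_comp, hfac, _root_.sub_apply, h, Complex.coe_smul,
      Algebra.algebraMap_eq_smul_one]
    exact sub_self _
  have h1 : (R - algebraMap ℝ (H →L[ℂ] H) r) u = 0 := by
    have h2 := congrArg (V⁻¹ : (H →L[ℂ] H)ˣ).val h0
    rw [← hV, ← mul_apply_eq_comp, Units.inv_mul, _root_.map_zero] at h2
    exact h2
  rw [_root_.sub_apply, Algebra.algebraMap_eq_smul_one] at h1
  rw [Complex.coe_smul]
  exact sub_eq_zero.1 h1

end LinearPMap.IsUnitResolvent

theorem spectrum_eq_continuousSpectrum_of_isSelfAdjoint {T : H →L[ℂ] H} (hT : IsSelfAdjoint T)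
    (h : ∀ z ∈ spectrum ℝ T, ∀ u, T u = (z : ℂ) • u → u = 0) :
    spectrum ℂ T = continuousSpectrum T := by
  refine Set.Subset.antisymm (fun ζ hζ => ?_) fun ζ hζ => hζ.1
  have hζ' := hζ
  rw [← hT.spectrumRestricts.algebraMap_image] at hζ'
  obtain ⟨z, hz, rfl⟩ := hζ'
  change ((z : ℝ) : ℂ) ∈ continuousSpectrum T
  set T' : H →L[ℂ] H := T - (z : ℂ) • ContinuousLinearMap.id ℂ H with hT'
  have hinj : ∀ u, T' u = 0 → u = 0 := fun u hu => h z hz u (sub_eq_zero.1 hu)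
  have hker : LinearMap.ker T'.toLinearMap = ⊥ := LinearMap.ker_eq_bot'.2 hinj
  have hsa : IsSelfAdjoint T' := by
    refine hT.sub (IsSelfAdjoint.smul ?_ (IsSelfAdjoint.one (H →L[ℂ] H)))
    exact Complex.conj_ofReal z
  refine ⟨hζ, hker, fun hsurj => ?_, ?_⟩
  · have hu : IsUnit T' := by
      rw [ContinuousLinearMap.isUnit_iff_bijective]
      exact ⟨LinearMap.ker_eq_bot.1 hker, hsurj⟩
    refine spectrum.mem_iff.1 hζ ?_
    have := hu.neg
    rw [hT', neg_sub] at this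
    exact this
  · rw [DenseRange, ← ContinuousLinearMap.coe_coe, ← LinearMap.coe_range,
      Submodule.dense_iff_topologicalClosure_eq_top, Submodule.topologicalClosure_eq_top_iff,
      Submodule.eq_bot_iff]
    intro x hx
    refine hinj x (ext_inner_right ℂ fun y => ?_)
    rw [inner_zero_left, show inner ℂ (T' x) y = inner ℂ x (T' y) from hsa.isSymmetric x y]
    exact Submodule.inner_left_of_mem_orthogonal (LinearMap.mem_range_self _ y) hx

theorem LinearPMap.IsNonposSelfAdjoint.spectrum_semigroupGeneratedBy [Nontrivial H]
    [TopologicalSpace.SeparableSpace H] (hA : A.IsNonposSelfAdjoint)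
    (hker : ∀ u, (u, 0) ∈ A.graph → u = 0) (hS : A.IsSimilarToMultiples) {t : ℝ≥0} (ht : 0 < t) :
    spectrum ℂ (semigroupGeneratedBy A t) = continuousSpectrum (semigroupGeneratedBy A t) ∧
    continuousSpectrum (semigroupGeneratedBy A t) =
      (fun x : ℝ => (x : ℂ)) '' Set.Icc (0 : ℝ) 1 := by
  obtain ⟨R, hR⟩ := hA.exists_resolvent
  rw [semigroupGeneratedBy_eq_resolventSemigroup hA hR]
  have hsa : IsSelfAdjoint (resolventSemigroup R t) :=
    LinearPMap.IsUnitResolvent.isSelfAdjoint_resolventSemigroup ht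
  have hspec := hR.spectrum_resolventSemigroup hker hS ht
  have h := spectrum_eq_continuousSpectrum_of_isSelfAdjoint hsa fun z hz u hu =>
    hR.eq_zero_of_resolventSemigroup_eq_smul hA hker hS ht (hspec ▸ hz) hu
  refine ⟨h, ?_⟩
  rw [← h, ← hsa.spectrumRestricts.algebraMap_image, hspec]
  rfl

end Spectrum

/-! ### Essential self-adjointness -/

section EssentialSelfAdjointness

variable {H : Type*} [NormedAddCommGroup H] [InnerProductSpace ℂ H] [CompleteSpace H]
  {A : H →ₗ.[ℂ] H}

theorem LinearPMap.isClosable_of_symm (hdense : Dense (A.domain : Set H))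
    (hsymm : ∀ p ∈ A.graph, ∀ q ∈ A.graph, inner ℂ p.2 q.1 = inner ℂ p.1 q.2) :
    A.IsClosable := by
  have h : A.IsFormalAdjoint A := fun x y => hsymm _ (A.mem_graph x) _ (A.mem_graph y)
  exact (LinearPMap.adjoint_isClosed hdense).isClosable.leIsClosable (h.le_adjoint hdense)

/-- A densely defined symmetric nonpositive operator `A` such that `1 - A` has dense range is
essentially self-adjoint. -/
theorem LinearPMap.isNonposSelfAdjoint_closure (hdense : Dense (A.domain : Set H))
    (hsymm : ∀ p ∈ A.graph, ∀ q ∈ A.graph, inner ℂ p.2 q.1 = inner ℂ p.1 q.2)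
    (hneg : ∀ p ∈ A.graph, (inner ℂ p.1 p.2).re ≤ 0)
    (horth : ∀ u, (∀ p ∈ A.graph, inner ℂ u (p.1 - p.2) = 0) → u = 0) :
    A.closure.IsNonposSelfAdjoint := by
  have hgraph := (LinearPMap.isClosable_of_symm hdense hsymm).graph_closure_eq_closure_graph
  have hneg' : ∀ p ∈ A.closure.graph, (inner ℂ p.1 p.2).re ≤ 0 := by
    intro p hp
    rw [← hgraph] at hp
    refine closure_minimal (t := {p : H × H | (inner ℂ p.1 p.2).re ≤ 0}) hneg ?_ hp
    exact isClosed_le (by fun_prop) continuous_const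
  refine ⟨fun p hp q hq => ?_, hneg', fun x => ?_⟩
  · rw [← hgraph] at hp hq
    have h1 : ∀ p ∈ A.graph, inner ℂ p.2 q.1 = inner ℂ p.1 q.2 := fun p hp =>
      closure_minimal (t := {q : H × H | inner ℂ p.2 q.1 = inner ℂ p.1 q.2}) (hsymm p hp)
        (isClosed_eq (by fun_prop) (by fun_prop)) hq
    exact closure_minimal (t := {p : H × H | inner ℂ p.2 q.1 = inner ℂ p.1 q.2}) h1
      (isClosed_eq (by fun_prop) (by fun_prop)) hp
  · let T : H × H →ₗ[ℂ] H := LinearMap.fst ℂ H H - LinearMap.snd ℂ H H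
    have hd : Dense ((A.graph.map T : Submodule ℂ H) : Set H) := by
      rw [Submodule.dense_iff_topologicalClosure_eq_top, Submodule.topologicalClosure_eq_top_iff,
        Submodule.eq_bot_iff]
      exact fun u hu => horth u fun p hp =>
        Submodule.inner_left_of_mem_orthogonal (Submodule.mem_map_of_mem hp) hu
    obtain ⟨y, hy, hyx⟩ := mem_closure_iff_seq_limit.1 (hd x)
    choose p hp hpy using hy
    have hpy' : ∀ k, (p k).1 - (p k).2 = y k := hpy
    have hcauchy : CauchySeq fun k => (p k).1 := by
      rw [Metric.cauchySeq_iff]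
      intro ε hε
      obtain ⟨N, hN⟩ := Metric.cauchySeq_iff.1 hyx.cauchySeq ε hε
      refine ⟨N, fun k hk l hl => lt_of_le_of_lt ?_ (hN k hk l hl)⟩
      have h1 := norm_le_norm_sub_of_re_inner_nonpos
        (hneg _ (A.graph.sub_mem (hp k) (hp l)))
      rw [dist_eq_norm, dist_eq_norm, ← hpy', ← hpy']
      rwa [Prod.fst_sub, Prod.snd_sub, sub_sub_sub_comm] at h1
    obtain ⟨u, hu⟩ := cauchySeq_tendsto_of_complete hcauchy
    have hw : Tendsto (fun k => (p k).2) atTop (𝓝 (u - x)) :=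
      (hu.sub hyx).congr fun k => by rw [← hpy']; abel
    refine ⟨(u, u - x), ?_, sub_sub_cancel u x⟩
    rw [← hgraph]
    exact mem_closure_of_tendsto (hu.prodMk_nhds hw) (Eventually.of_forall hp)

end EssentialSelfAdjointness

/-! ### Calculus of the horizontal vector fields -/

instance (n m : ℕ) : (volume : Measure (CarnotPoint n m)).IsAddHaarMeasure :=
  inferInstanceAs ((volume : Measure (EuclideanSpace ℝ (Fin n))).prod
    (volume : Measure (EuclideanSpace ℝ (Fin m)))).IsAddHaarMeasure

namespace StepTwoCarnotGroup

variable {n m : ℕ} (G : StepTwoCarnotGroup n m)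

/-- The derivative `Zᵢ f` along the `i`-th left-invariant horizontal vector field. -/
noncomputable def hDeriv (i : Fin n) (f : CarnotPoint n m → ℂ) : CarnotPoint n m → ℂ :=
  G.leftInvariant (horizontalBasis m i) f

/-- The value of the vector field `Zᵢ` at `g`. -/
noncomputable def hField (i : Fin n) (g : CarnotPoint n m) : CarnotPoint n m :=
  (EuclideanSpace.single i 1, (1 / 2 : ℝ) • G.bracket g.1 (EuclideanSpace.single i 1))

theorem hDeriv_apply (i : Fin n) {f : CarnotPoint n m → ℂ} (hf : Differentiable ℝ f)
    (g : CarnotPoint n m) : G.hDeriv i f g = fderiv ℝ f g (G.hField i g) := by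
  simp [hDeriv, G.leftInvariant_eq_fderiv _ hf, horizontalBasis, hField]

theorem contDiff_bracket {X : Type*} [NormedAddCommGroup X] [NormedSpace ℝ X] {k : WithTop ℕ∞}
    {a b : X → EuclideanSpace ℝ (Fin n)} (ha : ContDiff ℝ k a) (hb : ContDiff ℝ k b) :
    ContDiff ℝ k fun x => G.bracket (a x) (b x) := by
  let B : EuclideanSpace ℝ (Fin n) →L[ℝ] EuclideanSpace ℝ (Fin n) →L[ℝ]
      EuclideanSpace ℝ (Fin m) :=
    LinearMap.toContinuousLinearMap
      ((LinearMap.toContinuousLinearMap (𝕜 := ℝ) (E := EuclideanSpace ℝ (Fin n))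
        (F' := EuclideanSpace ℝ (Fin m))).toLinearMap ∘ₗ G.bracket)
  exact (B.contDiff.comp ha).clm_apply hb

theorem contDiff_hField (i : Fin n) {k : WithTop ℕ∞} : ContDiff ℝ k (G.hField i) :=
  contDiff_const.prodMk ((G.contDiff_bracket contDiff_fst contDiff_const).const_smul _)

theorem contDiff_hDeriv (i : Fin n) {f : CarnotPoint n m → ℂ} (hf : ContDiff ℝ ∞ f) :
    ContDiff ℝ ∞ (G.hDeriv i f) := by
  rw [funext (G.hDeriv_apply i (hf.differentiable (by simp)))]
  exact (hf.fderiv_right (by simp)).clm_apply (G.contDiff_hField i)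

theorem hDeriv_mem (i : Fin n) {f : CarnotPoint n m → ℂ} (hf : f ∈ carnotTestFunctions n m) :
    G.hDeriv i f ∈ carnotTestFunctions n m :=
  G.leftInvariant_mem _ hf

theorem hDeriv_mul (i : Fin n) {f f' : CarnotPoint n m → ℂ} (hf : Differentiable ℝ f)
    (hf' : Differentiable ℝ f') (g : CarnotPoint n m) :
    G.hDeriv i (fun x => f x * f' x) g = f g * G.hDeriv i f' g + G.hDeriv i f g * f' g := by
  have h : Differentiable ℝ fun x => f x * f' x := hf.mul hf'
  rw [G.hDeriv_apply i h, G.hDeriv_apply i hf, G.hDeriv_apply i hf',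
    show (fun x => f x * f' x) = f * f' from rfl, fderiv_mul (hf g) (hf' g)]
  simp [mul_comm]

theorem hDeriv_conj (i : Fin n) {f : CarnotPoint n m → ℂ} (hf : Differentiable ℝ f)
    (g : CarnotPoint n m) :
    G.hDeriv i (fun x => starRingEnd ℂ (f x)) g = starRingEnd ℂ (G.hDeriv i f g) := by
  have h1 := Complex.conjCLE.toContinuousLinearMap.hasFDerivAt.comp g (hf g).hasFDerivAt
  have h2 : Differentiable ℝ fun x => starRingEnd ℂ (f x) :=
    Complex.conjCLE.differentiable.comp hf
  rw [G.hDeriv_apply i h2, G.hDeriv_apply i hf]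
  exact congrArg (fun L => L (G.hField i g)) h1.fderiv

/-- The shear `(h, v) ↦ (h, v + (s hᵢ / 2) ω(h, eᵢ))`. For `s = 1` it carries the constant field
`(eᵢ, 0)` to `Zᵢ`. -/
noncomputable def shear (i : Fin n) (s : ℝ) (g : CarnotPoint n m) : CarnotPoint n m :=
  (g.1, (s * g.1 i / 2) • G.bracket g.1 (EuclideanSpace.single i 1) + g.2)

theorem contDiff_shear (i : Fin n) (s : ℝ) {k : WithTop ℕ∞} : ContDiff ℝ k (G.shear i s) := by
  have h1 : ContDiff ℝ k fun g : CarnotPoint n m => g.1 i :=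
    (EuclideanSpace.proj (𝕜 := ℝ) i).contDiff.comp contDiff_fst
  have h2 : ContDiff ℝ k fun g : CarnotPoint n m => s * g.1 i / 2 :=
    (contDiff_const.mul h1).div_const 2
  have h3 : ContDiff ℝ k fun g : CarnotPoint n m => G.bracket g.1 (EuclideanSpace.single i 1) :=
    G.contDiff_bracket contDiff_fst contDiff_const
  exact contDiff_fst.prodMk ((h2.smul h3).add contDiff_snd)

theorem shear_shear_neg (i : Fin n) (s : ℝ) (g : CarnotPoint n m) :
    G.shear i s (G.shear i (-s) g) = g := by
  refine Prod.ext rfl ?_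
  simp only [shear, ← add_assoc, ← add_smul]
  rw [show s * g.1 i / 2 + -s * g.1 i / 2 = 0 by ring, zero_smul, zero_add]

/-- The shear as a homeomorphism. -/
noncomputable def shearHomeomorph (i : Fin n) : CarnotPoint n m ≃ₜ CarnotPoint n m where
  toFun := G.shear i 1
  invFun := G.shear i (-1)
  left_inv g := by simpa using G.shear_shear_neg i (-1) g
  right_inv g := G.shear_shear_neg i 1 g
  continuous_toFun := (G.contDiff_shear i 1 (k := 0)).continuous
  continuous_invFun := (G.contDiff_shear i (-1) (k := 0)).continuous

theorem measurePreserving_shear (i : Fin n) (s : ℝ) :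
    MeasurePreserving (G.shear i s) volume volume := by
  have hm : Measurable fun p : CarnotPoint n m => (G.shear i s p).2 :=
    (G.contDiff_shear i s (k := 0)).continuous.measurable.snd
  exact (MeasurePreserving.id volume).skew_product
    (g := fun h v => (s * h i / 2) • G.bracket h (EuclideanSpace.single i 1) + v) hm
    (Eventually.of_forall fun h => map_add_left_eq_self volume _)

theorem hasLineDerivAt_comp_shear (i : Fin n) {f : CarnotPoint n m → ℂ}
    (hf : Differentiable ℝ f) (g : CarnotPoint n m) :
    HasLineDerivAt ℝ (f ∘ G.shear i 1) (G.hDeriv i f (G.shear i 1 g)) g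
      (EuclideanSpace.single i 1, 0) := by
  have h1 := ((hf (G.shear i 1 g)).hasFDerivAt).hasLineDerivAt (G.hField i (G.shear i 1 g))
  rw [← G.hDeriv_apply i hf] at h1
  refine HasDerivAt.congr_of_eventuallyEq h1 (Eventually.of_forall fun t => ?_)
  refine congrArg f (Prod.ext rfl ?_)
  have : G.bracket (EuclideanSpace.single i 1) (EuclideanSpace.single i 1) = 0 := G.bracket_self _
  simp only [shear, hField, Prod.fst_add, Prod.snd_add, Prod.smul_fst, Prod.smul_snd, map_add,
    map_smul, LinearMap.add_apply, LinearMap.smul_apply, this, smul_zero, add_zero,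
    PiLp.add_apply, PiLp.smul_apply, PiLp.single_apply, if_true, smul_eq_mul]
  module

/-- Integration by parts for `Zᵢ`: the shear is volume preserving and straightens `Zᵢ`. -/
theorem integral_mul_hDeriv (i : Fin n) {u f : CarnotPoint n m → ℂ} (hu : ContDiff ℝ ∞ u)
    (hf : f ∈ carnotTestFunctions n m) :
    ∫ g, u g * G.hDeriv i f g = -∫ g, G.hDeriv i u g * f g := by
  have hcomp : ∀ F : CarnotPoint n m → ℂ, ∫ g, F (G.shear i 1 g) = ∫ g, F g := fun F =>
    (G.measurePreserving_shear i 1).integral_comp (G.shearHomeomorph i).measurableEmbedding F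
  have hint : ∀ a b : CarnotPoint n m → ℂ, Continuous a → b ∈ carnotTestFunctions n m →
      Integrable fun g => a (G.shear i 1 g) * b (G.shear i 1 g) := fun a b ha hb => by
    have h1 : Integrable fun g => a g * b g :=
      (ha.mul hb.1.continuous).integrable_of_hasCompactSupport hb.2.mul_left
    exact (G.measurePreserving_shear i 1).integrable_comp_of_integrable h1
  have hdu : Differentiable ℝ u := hu.differentiable (by simp)
  have hdf : Differentiable ℝ f := hf.1.differentiable (by simp)
  rw [← hcomp, ← hcomp (fun g => G.hDeriv i u g * f g)]
  exact integral_bilinear_hasLineDerivAt_right_eq_neg_left_of_integrable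
    (B := ContinuousLinearMap.mul ℝ ℂ)
    (hint _ _ (G.contDiff_hDeriv i hu).continuous hf)
    (hint _ _ hu.continuous (G.hDeriv_mem i hf)) (hint _ _ hu.continuous hf)
    (fun g _ => G.hasLineDerivAt_comp_shear i hdu g)
    (fun g _ => G.hasLineDerivAt_comp_shear i hdf g)

theorem subLaplacianFun_mem {f : CarnotPoint n m → ℂ} (hf : f ∈ carnotTestFunctions n m) :
    G.subLaplacianFun f ∈ carnotTestFunctions n m := by
  have := (G.subLaplacianTest ⟨f, hf⟩).2
  rwa [G.subLaplacianTest_apply] at this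

theorem integrable_mul {u f : CarnotPoint n m → ℂ} (hu : Continuous u)
    (hf : f ∈ carnotTestFunctions n m) : Integrable fun g => u g * f g :=
  (hu.mul hf.1.continuous).integrable_of_hasCompactSupport hf.2.mul_left

theorem integral_mul_subLaplacianFun {u f : CarnotPoint n m → ℂ} (hu : ContDiff ℝ ∞ u)
    (hf : f ∈ carnotTestFunctions n m) :
    ∫ g, u g * G.subLaplacianFun f g = -∑ i, ∫ g, G.hDeriv i u g * G.hDeriv i f g := by
  have h1 : ∀ g, u g * G.subLaplacianFun f g = ∑ i, u g * G.hDeriv i (G.hDeriv i f) g :=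
    fun g => Finset.mul_sum _ _ _
  simp_rw [h1]
  rw [integral_finsetSum _ fun i _ =>
    integrable_mul hu.continuous (G.hDeriv_mem i (G.hDeriv_mem i hf)), ← Finset.sum_neg_distrib]
  exact Finset.sum_congr rfl fun i _ => G.integral_mul_hDeriv i hu (G.hDeriv_mem i hf)

end StepTwoCarnotGroup

/-! ### The sub-Laplacian on test functions -/

section TestFunctions

variable {n m : ℕ}

theorem conj_mem_carnotTestFunctions {f : CarnotPoint n m → ℂ}
    (hf : f ∈ carnotTestFunctions n m) :
    (fun g => starRingEnd ℂ (f g)) ∈ carnotTestFunctions n m :=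
  ⟨Complex.conjCLE.contDiff.comp hf.1, hf.2.comp_left (g := starRingEnd ℂ) (map_zero _)⟩

theorem mul_mem_carnotTestFunctions {a f : CarnotPoint n m → ℂ} (ha : ContDiff ℝ ∞ a)
    (hf : f ∈ carnotTestFunctions n m) : (fun g => a g * f g) ∈ carnotTestFunctions n m :=
  ⟨ha.mul hf.1, hf.2.mul_left⟩

theorem coeFn_carnotTestToL2 (f : carnotTestFunctions n m) :
    carnotTestToL2 n m f =ᵐ[volume] (f : CarnotPoint n m → ℂ) :=
  (carnotTestFunctions_memLp f).coeFn_toLp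

theorem norm_carnotTestToL2 (f : carnotTestFunctions n m) :
    ‖carnotTestToL2 n m f‖ = (eLpNorm (f : CarnotPoint n m → ℂ) 2 volume).toReal :=
  Lp.norm_toLp _ (carnotTestFunctions_memLp f)

theorem inner_carnotTestToL2_left (f : carnotTestFunctions n m) (u : CarnotL2 n m) :
    inner ℂ (carnotTestToL2 n m f) u = ∫ g, starRingEnd ℂ (f.1 g) * u g := by
  rw [L2.inner_def]
  refine integral_congr_ae ?_
  filter_upwards [coeFn_carnotTestToL2 f] with g hg
  rw [hg, RCLike.inner_apply, mul_comm]

theorem inner_carnotTestToL2 (f f' : carnotTestFunctions n m) :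
    inner ℂ (carnotTestToL2 n m f) (carnotTestToL2 n m f') =
      ∫ g, starRingEnd ℂ (f.1 g) * f'.1 g := by
  rw [inner_carnotTestToL2_left]
  refine integral_congr_ae ?_
  filter_upwards [coeFn_carnotTestToL2 f'] with g hg
  rw [hg]

theorem ae_eq_zero_of_integral_mul_carnotTest {u : CarnotPoint n m → ℂ}
    (hu : LocallyIntegrable u) (h : ∀ f ∈ carnotTestFunctions n m, ∫ g, f g * u g = 0) :
    u =ᵐ[volume] 0 := by
  refine ae_eq_zero_of_integral_contDiff_smul_eq_zero hu fun a ha ha' => ?_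
  have h1 := h (fun g => (a g : ℂ)) ⟨Complex.ofRealCLM.contDiff.comp ha,
    ha'.comp_left (g := fun x : ℝ => (x : ℂ)) Complex.ofReal_zero⟩
  simpa only [Complex.real_smul] using h1

theorem CarnotL2.locallyIntegrable (u : CarnotL2 n m) : LocallyIntegrable u :=
  (Lp.memLp u).locallyIntegrable one_le_two

theorem CarnotL2.eq_zero_of_inner_test {u : CarnotL2 n m}
    (h : ∀ f, inner ℂ (carnotTestToL2 n m f) u = 0) : u = 0 := by
  rw [Lp.eq_zero_iff_ae_eq_zero]
  refine ae_eq_zero_of_integral_mul_carnotTest u.locallyIntegrable fun f hf => ?_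
  have := h ⟨_, conj_mem_carnotTestFunctions hf⟩
  rw [inner_carnotTestToL2_left] at this
  simpa using this

end TestFunctions

namespace StepTwoCarnotGroup

variable {n m : ℕ} (G : StepTwoCarnotGroup n m)

theorem mem_graph_subLaplacianCore {p : CarnotL2 n m × CarnotL2 n m} :
    p ∈ G.subLaplacianCore.graph ↔
      ∃ f, (carnotTestToL2 n m f, carnotTestToL2 n m (G.subLaplacianTest f)) = p := by
  rw [LinearPMap.mem_graph_iff]
  constructor
  · rintro ⟨⟨_, f, rfl⟩, h1, h2⟩
    refine ⟨f, Prod.ext h1 ?_⟩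
    rw [← h2]
    exact (G.subLaplacianCore_apply f).symm
  · rintro ⟨f, rfl⟩
    exact ⟨⟨_, LinearMap.mem_range_self _ f⟩, rfl, G.subLaplacianCore_apply f⟩

/-- `Zᵢ` as a map of test functions. -/
noncomputable def hDerivTest (i : Fin n) (f : carnotTestFunctions n m) :
    carnotTestFunctions n m := ⟨G.hDeriv i f.1, G.hDeriv_mem i f.2⟩

theorem inner_subLaplacianTest (f f' : carnotTestFunctions n m) :
    inner ℂ (carnotTestToL2 n m f) (carnotTestToL2 n m (G.subLaplacianTest f')) =
      -∑ i, inner ℂ (carnotTestToL2 n m (G.hDerivTest i f))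
        (carnotTestToL2 n m (G.hDerivTest i f')) := by
  simp_rw [inner_carnotTestToL2, G.subLaplacianTest_apply]
  rw [G.integral_mul_subLaplacianFun (conj_mem_carnotTestFunctions f.2).1 f'.2]
  refine congrArg Neg.neg (Finset.sum_congr rfl fun i _ => ?_)
  simp_rw [G.hDeriv_conj i (f.2.1.differentiable (by simp))]
  rfl

theorem inner_subLaplacianTest_left (f f' : carnotTestFunctions n m) :
    inner ℂ (carnotTestToL2 n m (G.subLaplacianTest f)) (carnotTestToL2 n m f') =
      inner ℂ (carnotTestToL2 n m f) (carnotTestToL2 n m (G.subLaplacianTest f')) := by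
  rw [← inner_conj_symm, G.inner_subLaplacianTest, G.inner_subLaplacianTest, map_neg, map_sum]
  simp_rw [inner_conj_symm]

theorem re_inner_subLaplacianTest_self (f : carnotTestFunctions n m) :
    (inner ℂ (carnotTestToL2 n m f) (carnotTestToL2 n m (G.subLaplacianTest f))).re =
      -∑ i, ‖carnotTestToL2 n m (G.hDerivTest i f)‖ ^ 2 := by
  rw [G.inner_subLaplacianTest, Complex.neg_re, Complex.re_sum]
  refine congrArg Neg.neg (Finset.sum_congr rfl fun i _ => ?_)
  exact (norm_sq_eq_re_inner (𝕜 := ℂ) _).symm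

theorem norm_hDerivTest_sq_le (i : Fin n) (f : carnotTestFunctions n m) :
    ‖carnotTestToL2 n m (G.hDerivTest i f)‖ ^ 2 ≤
      ‖carnotTestToL2 n m f‖ * ‖carnotTestToL2 n m (G.subLaplacianTest f)‖ := by
  have h1 := Finset.single_le_sum
    (f := fun i => ‖carnotTestToL2 n m (G.hDerivTest i f)‖ ^ 2)
    (fun i _ => sq_nonneg _) (Finset.mem_univ i)
  have h2 := G.re_inner_subLaplacianTest_self f
  have h3 := (Complex.abs_re_le_norm _).trans
    (norm_inner_le_norm (𝕜 := ℂ) (carnotTestToL2 n m f) (carnotTestToL2 n m (G.subLaplacianTest f)))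
  have h4 := neg_le_abs
    (inner ℂ (carnotTestToL2 n m f) (carnotTestToL2 n m (G.subLaplacianTest f))).re
  linarith

theorem dense_domain_subLaplacianCore :
    Dense (G.subLaplacianCore.domain : Set (CarnotL2 n m)) := by
  rw [Submodule.dense_iff_topologicalClosure_eq_top, Submodule.topologicalClosure_eq_top_iff,
    Submodule.eq_bot_iff]
  exact fun u hu => CarnotL2.eq_zero_of_inner_test fun f =>
    Submodule.inner_right_of_mem_orthogonal (LinearMap.mem_range_self _ f) hu

theorem symm_subLaplacianCore : ∀ p ∈ G.subLaplacianCore.graph, ∀ q ∈ G.subLaplacianCore.graph,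
    inner ℂ p.2 q.1 = inner ℂ p.1 q.2 := by
  intro p hp q hq
  obtain ⟨f, rfl⟩ := G.mem_graph_subLaplacianCore.1 hp
  obtain ⟨f', rfl⟩ := G.mem_graph_subLaplacianCore.1 hq
  exact G.inner_subLaplacianTest_left f f'

theorem nonpos_subLaplacianCore : ∀ p ∈ G.subLaplacianCore.graph,
    (inner ℂ p.1 p.2).re ≤ 0 := by
  intro p hp
  obtain ⟨f, rfl⟩ := G.mem_graph_subLaplacianCore.1 hp
  rw [G.re_inner_subLaplacianTest_self, neg_nonpos]
  exact Finset.sum_nonneg fun i _ => sq_nonneg _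

theorem graph_subLaplacian :
    G.subLaplacianCore.graph.topologicalClosure = G.subLaplacian.graph :=
  (LinearPMap.isClosable_of_symm G.dense_domain_subLaplacianCore
    G.symm_subLaplacianCore).graph_closure_eq_closure_graph

/-! ### The sub-Laplacian is injective -/

theorem horizontal_pos (G : StepTwoCarnotGroup n m) : 0 < n := by
  rcases Nat.eq_zero_or_pos n with rfl | h
  · exfalso
    have h1 : Submodule.span ℝ {v | ∃ h h', G.bracket h h' = v} = ⊥ := by
      rw [Submodule.span_eq_bot]
      rintro _ ⟨h, h', rfl⟩
      rw [Subsingleton.elim h 0, map_zero, LinearMap.zero_apply]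
    have h2 := Submodule.finrank_eq_zero.2 (G.span_bracket.symm.trans h1)
    rw [finrank_top, finrank_euclideanSpace_fin] at h2
    exact G.vertical_pos.ne' h2
  · exact h

theorem hDeriv_coord (i : Fin n) {a : ℝ → ℝ} {a' : ℝ} {g : CarnotPoint n m}
    (ha : HasDerivAt a a' (g.1 i)) : G.hDeriv i (fun g => (a (g.1 i) : ℂ)) g = a' := by
  have h1 : HasDerivAt (fun t : ℝ => g.1 i + t) 1 0 := (hasDerivAt_id 0).const_add _
  have h2 : HasDerivAt a a' (g.1 i + 0) := by rwa [add_zero]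
  have h3 := ((h2.comp (0 : ℝ) h1).ofReal_comp).deriv
  rw [mul_one] at h3
  rw [← h3, hDeriv, leftInvariant]
  congr 1
  funext t
  simp [mul, horizontalBasis]

theorem contDiff_coord (i : Fin n) {a : ℝ → ℝ} (ha : ContDiff ℝ ∞ a) :
    ContDiff ℝ ∞ fun g : CarnotPoint n m => (a (g.1 i) : ℂ) := by
  have h1 : ContDiff ℝ ∞ fun g : CarnotPoint n m => g.1 i :=
    (EuclideanSpace.proj (𝕜 := ℝ) i).contDiff.comp contDiff_fst
  exact Complex.ofRealCLM.contDiff.comp (ha.comp h1)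

/-- A Hardy type inequality: `∫ |f|² / cosh² hᵢ ≤ 2 ‖f‖ ‖Zᵢ f‖`. It follows from integration by
parts, as `Zᵢ (tanh hᵢ) = 1 / cosh² hᵢ`. -/
theorem norm_mul_inv_cosh_sq_le (i : Fin n) (f w : carnotTestFunctions n m)
    (hw : ∀ g, w.1 g = (((Real.cosh (g.1 i))⁻¹ : ℝ) : ℂ) * f.1 g) :
    ‖carnotTestToL2 n m w‖ ^ 2 ≤
      2 * (‖carnotTestToL2 n m f‖ * ‖carnotTestToL2 n m (G.hDerivTest i f)‖) := by
  set a : ℝ → ℝ := fun x => Real.sinh x / Real.cosh x with ha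
  have hac : ContDiff ℝ ∞ a := Real.contDiff_sinh.div Real.contDiff_cosh
    fun x => (Real.cosh_pos x).ne'
  have hderiv : ∀ x, HasDerivAt a ((Real.cosh x)⁻¹ ^ 2) x := fun x => by
    have h := (Real.hasDerivAt_sinh x).div (Real.hasDerivAt_cosh x) (Real.cosh_pos x).ne'
    refine h.congr_deriv ?_
    have h2 := Real.cosh_sq x
    rw [inv_pow, div_eq_iff (pow_ne_zero 2 (Real.cosh_pos x).ne'),
      inv_mul_cancel₀ (pow_ne_zero 2 (Real.cosh_pos x).ne')]
    linarith [h2, sq (Real.cosh x), sq (Real.sinh x)]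
  have ha1 : ∀ x, |a x| ≤ 1 := fun x => by
    rw [ha, abs_div, abs_of_pos (Real.cosh_pos x), div_le_one (Real.cosh_pos x)]
    refine abs_le_of_sq_le_sq ?_ (Real.cosh_pos x).le
    linarith [Real.cosh_sq x]
  have hsm := contDiff_coord (n := n) (m := m) i hac
  let F : carnotTestFunctions n m := ⟨_, mul_mem_carnotTestFunctions hsm f.2⟩
  have hF : ‖carnotTestToL2 n m F‖ ≤ ‖carnotTestToL2 n m f‖ := by
    refine Lp.norm_le_norm_of_ae_le ?_
    filter_upwards [coeFn_carnotTestToL2 F, coeFn_carnotTestToL2 f] with g h1 h2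
    rw [h1, h2]
    change ‖(a (g.1 i) : ℂ) * f.1 g‖ ≤ _
    rw [norm_mul, Complex.norm_real, Real.norm_eq_abs]
    exact mul_le_of_le_one_left (norm_nonneg _) (ha1 _)
  have hdf : Differentiable ℝ f.1 := f.2.1.differentiable (by simp)
  have hsq : (fun g => f.1 g * starRingEnd ℂ (f.1 g)) ∈ carnotTestFunctions n m :=
    mul_mem_carnotTestFunctions f.2.1 (conj_mem_carnotTestFunctions f.2)
  have hibp := G.integral_mul_hDeriv i hsm hsq
  have h1 : (∫ g, G.hDeriv i (fun g => (a (g.1 i) : ℂ)) g * (f.1 g * starRingEnd ℂ (f.1 g))) =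
      inner ℂ (carnotTestToL2 n m w) (carnotTestToL2 n m w) := by
    rw [inner_carnotTestToL2]
    refine integral_congr_ae (Eventually.of_forall fun g => ?_)
    simp only [G.hDeriv_coord i (hderiv _), hw, map_mul, Complex.conj_ofReal]
    push_cast
    ring
  have h2 : (∫ g, (a (g.1 i) : ℂ) * G.hDeriv i (fun g => f.1 g * starRingEnd ℂ (f.1 g)) g) =
      inner ℂ (carnotTestToL2 n m (G.hDerivTest i f)) (carnotTestToL2 n m F) +
      inner ℂ (carnotTestToL2 n m F) (carnotTestToL2 n m (G.hDerivTest i f)) := by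
    rw [inner_carnotTestToL2, inner_carnotTestToL2, ← integral_add
      (integrable_mul (conj_mem_carnotTestFunctions (G.hDerivTest i f).2).1.continuous F.2)
      (integrable_mul (conj_mem_carnotTestFunctions F.2).1.continuous (G.hDerivTest i f).2)]
    refine integral_congr_ae (Eventually.of_forall fun g => ?_)
    have hd2 : Differentiable ℝ fun g => starRingEnd ℂ (f.1 g) :=
      (conj_mem_carnotTestFunctions f.2).1.differentiable (by simp)
    simp only [G.hDeriv_mul i hdf hd2, G.hDeriv_conj i hdf, hDerivTest, F, map_mul,
      Complex.conj_ofReal]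
    ring
  rw [h1, h2] at hibp
  have h3 : ‖carnotTestToL2 n m w‖ ^ 2 =
      ‖(inner ℂ (carnotTestToL2 n m w) (carnotTestToL2 n m w) : ℂ)‖ := by
    rw [inner_self_eq_norm_sq_to_K]
    simp
  rw [h3, ← norm_neg, ← hibp]
  refine (norm_add_le _ _).trans ?_
  have h4 := norm_inner_le_norm (𝕜 := ℂ) (carnotTestToL2 n m (G.hDerivTest i f))
    (carnotTestToL2 n m F)
  have h5 := norm_inner_le_norm (𝕜 := ℂ) (carnotTestToL2 n m F)
    (carnotTestToL2 n m (G.hDerivTest i f))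
  have h6 := mul_le_mul_of_nonneg_right hF (norm_nonneg (carnotTestToL2 n m (G.hDerivTest i f)))
  linarith [mul_comm ‖carnotTestToL2 n m (G.hDerivTest i f)‖ ‖carnotTestToL2 n m F‖]

/-- The Hardy type inequality bounds every pairing with a test function by a quantity that is
continuous in the graph norm and vanishes on the kernel. -/
theorem exists_norm_inner_pow_le (f : carnotTestFunctions n m) :
    ∃ C, ∀ p ∈ G.subLaplacian.graph,
      ‖(inner ℂ (carnotTestToL2 n m f) p.1 : ℂ)‖ ^ 4 ≤ C * (‖p.1‖ ^ 3 * ‖p.2‖) := by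
  let i : Fin n := ⟨0, G.horizontal_pos⟩
  have hρ : ContDiff ℝ ∞ fun x => (Real.cosh x)⁻¹ :=
    Real.contDiff_cosh.inv fun x => (Real.cosh_pos x).ne'
  let f₁ : carnotTestFunctions n m :=
    ⟨_, mul_mem_carnotTestFunctions (contDiff_coord i Real.contDiff_cosh) f.2⟩
  refine ⟨4 * ‖carnotTestToL2 n m f₁‖ ^ 4, fun p hp => ?_⟩
  rw [← G.graph_subLaplacian] at hp
  refine closure_minimal (t := {p : CarnotL2 n m × CarnotL2 n m |
    ‖(inner ℂ (carnotTestToL2 n m f) p.1 : ℂ)‖ ^ 4 ≤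
      4 * ‖carnotTestToL2 n m f₁‖ ^ 4 * (‖p.1‖ ^ 3 * ‖p.2‖)}) ?_
    (isClosed_le (by fun_prop) (by fun_prop)) hp
  intro p hp
  obtain ⟨u, rfl⟩ := G.mem_graph_subLaplacianCore.1 hp
  let w : carnotTestFunctions n m := ⟨_, mul_mem_carnotTestFunctions (contDiff_coord i hρ) u.2⟩
  have h1 := G.norm_mul_inv_cosh_sq_le i u w fun g => rfl
  have h2 := G.norm_hDerivTest_sq_le i u
  have h3 : inner ℂ (carnotTestToL2 n m f) (carnotTestToL2 n m u) =
      inner ℂ (carnotTestToL2 n m f₁) (carnotTestToL2 n m w) := by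
    rw [inner_carnotTestToL2, inner_carnotTestToL2]
    refine integral_congr_ae (Eventually.of_forall fun g => ?_)
    have : (Real.cosh (g.1 i) : ℂ) ≠ 0 := Complex.ofReal_ne_zero.2 (Real.cosh_pos _).ne'
    simp only [f₁, w, map_mul, Complex.conj_ofReal, Complex.ofReal_inv]
    field_simp
  simp only [Set.mem_ofPred_eq, h3]
  set U := ‖carnotTestToL2 n m u‖
  set Z := ‖carnotTestToL2 n m (G.hDerivTest i u)‖
  set W := ‖carnotTestToL2 n m w‖
  set D := ‖carnotTestToL2 n m (G.subLaplacianTest u)‖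
  set K := ‖carnotTestToL2 n m f₁‖
  calc ‖(inner ℂ (carnotTestToL2 n m f₁) (carnotTestToL2 n m w) : ℂ)‖ ^ 4
      ≤ (K * W) ^ 4 := by gcongr; exact norm_inner_le_norm _ _
    _ = K ^ 4 * (W ^ 2) ^ 2 := by ring
    _ ≤ K ^ 4 * (2 * (U * Z)) ^ 2 := by gcongr
    _ = 4 * K ^ 4 * (U ^ 2 * Z ^ 2) := by ring
    _ ≤ 4 * K ^ 4 * (U ^ 2 * (U * D)) := by gcongr
    _ = 4 * K ^ 4 * (U ^ 3 * D) := by ring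

theorem eq_zero_of_mem_graph_subLaplacian {u : CarnotL2 n m}
    (h : (u, 0) ∈ G.subLaplacian.graph) : u = 0 := by
  refine CarnotL2.eq_zero_of_inner_test fun f => ?_
  obtain ⟨C, hC⟩ := G.exists_norm_inner_pow_le f
  have h1 := hC _ h
  simp only [norm_zero, mul_zero] at h1
  have h2 := pow_eq_zero_iff (four_ne_zero) |>.1 (le_antisymm h1 (by positivity))
  exact norm_eq_zero.1 h2

end StepTwoCarnotGroup

/-! ### Dilations -/

section Dilation

variable {n m : ℕ}

/-- The dilation `(h, v) ↦ (s h, s² v)`, an automorphism of every step 2 Carnot group. -/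
noncomputable def carnotDilation (n m : ℕ) (s : ℝ) : CarnotPoint n m →ₗ[ℝ] CarnotPoint n m :=
  (s • LinearMap.id).prodMap (s ^ 2 • LinearMap.id)

theorem carnotDilation_apply (s : ℝ) (g : CarnotPoint n m) :
    carnotDilation n m s g = (s • g.1, s ^ 2 • g.2) := rfl

theorem contDiff_carnotDilation (s : ℝ) : ContDiff ℝ ∞ (carnotDilation n m s) :=
  (LinearMap.toContinuousLinearMap (carnotDilation n m s)).contDiff

theorem carnotDilation_comp_inv {s : ℝ} (hs : s ≠ 0) (g : CarnotPoint n m) :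
    carnotDilation n m s (carnotDilation n m s⁻¹ g) = g := by
  simp [carnotDilation_apply, smul_smul, hs]

/-- The dilation as a homeomorphism. -/
noncomputable def carnotDilationHomeomorph (n m : ℕ) {s : ℝ} (hs : s ≠ 0) :
    CarnotPoint n m ≃ₜ CarnotPoint n m where
  toFun := carnotDilation n m s
  invFun := carnotDilation n m s⁻¹
  left_inv g := by simpa using carnotDilation_comp_inv (inv_ne_zero hs) g
  right_inv g := carnotDilation_comp_inv hs g
  continuous_toFun := (contDiff_carnotDilation s).continuous
  continuous_invFun := (contDiff_carnotDilation s⁻¹).continuous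

theorem det_carnotDilation_ne_zero {s : ℝ} (hs : s ≠ 0) :
    LinearMap.det (carnotDilation n m s) ≠ 0 := by
  have h : carnotDilation n m s ∘ₗ carnotDilation n m s⁻¹ = LinearMap.id :=
    LinearMap.ext (carnotDilation_comp_inv hs)
  have h2 := congrArg LinearMap.det h
  rw [LinearMap.det_comp, LinearMap.det_id] at h2
  exact left_ne_zero_of_mul_eq_one h2

theorem map_carnotDilation {s : ℝ} (hs : s ≠ 0) :
    Measure.map (carnotDilation n m s) volume =
      ENNReal.ofReal |(LinearMap.det (carnotDilation n m s))⁻¹| •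
        (volume : Measure (CarnotPoint n m)) :=
  Measure.map_linearMap_addHaar_eq_smul_addHaar _ (det_carnotDilation_ne_zero hs)

theorem quasiMeasurePreserving_carnotDilation {s : ℝ} (hs : s ≠ 0) :
    Measure.QuasiMeasurePreserving (carnotDilation n m s) volume volume := by
  refine ⟨(contDiff_carnotDilation s).continuous.measurable, ?_⟩
  rw [map_carnotDilation hs]
  exact Measure.smul_absolutelyContinuous

theorem eLpNorm_comp_carnotDilation {s : ℝ} (hs : s ≠ 0) {u : CarnotPoint n m → ℂ}
    (hu : AEStronglyMeasurable u volume) :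
    eLpNorm (u ∘ carnotDilation n m s) 2 volume =
      ENNReal.ofReal |(LinearMap.det (carnotDilation n m s))⁻¹| ^ (1 / (2 : ENNReal)).toReal *
        eLpNorm u 2 volume := by
  have hu' : AEStronglyMeasurable u (Measure.map (carnotDilation n m s) volume) := by
    rw [map_carnotDilation hs]
    exact hu.mono_ac Measure.smul_absolutelyContinuous
  rw [← eLpNorm_map_measure hu' (contDiff_carnotDilation s).continuous.aemeasurable,
    map_carnotDilation hs, eLpNorm_smul_measure_of_ne_top (by simp), smul_eq_mul]

theorem MeasureTheory.MemLp.comp_carnotDilation {s : ℝ} (hs : s ≠ 0) {u : CarnotPoint n m → ℂ}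
    (hu : MemLp u 2 volume) : MemLp (u ∘ carnotDilation n m s) 2 volume := by
  refine ⟨hu.1.comp_quasiMeasurePreserving (quasiMeasurePreserving_carnotDilation hs), ?_⟩
  rw [eLpNorm_comp_carnotDilation hs hu.1]
  exact ENNReal.mul_lt_top (ENNReal.rpow_lt_top_of_nonneg (by simp) (by simp)) hu.2

/-- Composition with a dilation as a bounded operator on `L²(G)`. -/
noncomputable def carnotDilationL2 (n m : ℕ) {s : ℝ} (hs : s ≠ 0) :
    CarnotL2 n m →L[ℂ] CarnotL2 n m :=
  LinearMap.mkContinuous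
    { toFun := fun u => ((Lp.memLp u).comp_carnotDilation hs).toLp _
      map_add' := fun u w => by
        rw [← MemLp.toLp_add, MemLp.toLp_eq_toLp_iff]
        exact (quasiMeasurePreserving_carnotDilation hs).ae_eq_comp (Lp.coeFn_add u w)
      map_smul' := fun c u => by
        rw [RingHom.id_apply, ← MemLp.toLp_const_smul, MemLp.toLp_eq_toLp_iff]
        exact (quasiMeasurePreserving_carnotDilation hs).ae_eq_comp (Lp.coeFn_smul c u) }
    (ENNReal.ofReal |(LinearMap.det (carnotDilation n m s))⁻¹| ^ (1 / (2 : ENNReal)).toReal).toReal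
    (fun u => by
      change ‖((Lp.memLp u).comp_carnotDilation hs).toLp _‖ ≤ _
      rw [Lp.norm_toLp, eLpNorm_comp_carnotDilation hs (Lp.memLp u).1, ENNReal.toReal_mul,
        Lp.norm_def])

theorem carnotDilationL2_toLp {s : ℝ} (hs : s ≠ 0) {u : CarnotPoint n m → ℂ}
    (hu : MemLp u 2 volume) :
    carnotDilationL2 n m hs (hu.toLp u) = (hu.comp_carnotDilation hs).toLp _ :=
  (MemLp.toLp_eq_toLp_iff ((Lp.memLp _).comp_carnotDilation hs) _).2
    ((quasiMeasurePreserving_carnotDilation hs).ae_eq_comp hu.coeFn_toLp)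

theorem carnotDilationL2_comp_inv {s : ℝ} (hs : s ≠ 0) (u : CarnotL2 n m) :
    carnotDilationL2 n m (inv_ne_zero hs) (carnotDilationL2 n m hs u) = u := by
  have h : carnotDilationL2 n m hs u = ((Lp.memLp u).comp_carnotDilation hs).toLp _ := rfl
  rw [h, carnotDilationL2_toLp]
  conv_rhs => rw [← Lp.toLp_coeFn u (Lp.memLp u)]
  refine (MemLp.toLp_eq_toLp_iff _ _).2 (Eventually.of_forall fun g => ?_)
  exact congrArg u (carnotDilation_comp_inv hs g)

theorem comp_carnotDilation_mem {s : ℝ} (hs : s ≠ 0) {f : CarnotPoint n m → ℂ}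
    (hf : f ∈ carnotTestFunctions n m) :
    f ∘ carnotDilation n m s ∈ carnotTestFunctions n m :=
  ⟨hf.1.comp (contDiff_carnotDilation s),
    hf.2.comp_homeomorph (carnotDilationHomeomorph n m hs)⟩

namespace StepTwoCarnotGroup

variable (G : StepTwoCarnotGroup n m)

theorem hDeriv_comp_carnotDilation (i : Fin n) (s : ℝ) (f : CarnotPoint n m → ℂ)
    (g : CarnotPoint n m) :
    G.hDeriv i (f ∘ carnotDilation n m s) g = s * G.hDeriv i f (carnotDilation n m s g) := by
  have h := deriv_comp_mul_left s
    (fun t : ℝ => f (G.mul (carnotDilation n m s g) (t • horizontalBasis m i))) 0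
  rw [mul_zero] at h
  rw [hDeriv, hDeriv, leftInvariant, leftInvariant, ← Complex.real_smul, ← h]
  congr 1
  funext t
  refine congrArg f (Prod.ext ?_ ?_)
  · simp [mul, carnotDilation_apply, horizontalBasis, smul_smul]
  · simp only [mul, carnotDilation_apply, horizontalBasis, Prod.smul_mk, map_smul,
      LinearMap.smul_apply]
    module

theorem subLaplacianFun_comp_carnotDilation (s : ℝ) (f : CarnotPoint n m → ℂ) :
    G.subLaplacianFun (f ∘ carnotDilation n m s) =
      ((s ^ 2 : ℝ) : ℂ) • (G.subLaplacianFun f ∘ carnotDilation n m s) := by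
  funext g
  have h : ∀ i, G.hDeriv i (G.hDeriv i (f ∘ carnotDilation n m s)) g =
      ((s ^ 2 : ℝ) : ℂ) * G.hDeriv i (G.hDeriv i f) (carnotDilation n m s g) := fun i => by
    have h1 : G.hDeriv i (f ∘ carnotDilation n m s) =
        (s : ℂ) • (G.hDeriv i f ∘ carnotDilation n m s) :=
      funext fun g => G.hDeriv_comp_carnotDilation i s f g
    have h2 : G.hDeriv i ((s : ℂ) • (G.hDeriv i f ∘ carnotDilation n m s)) g =
        (s : ℂ) * G.hDeriv i (G.hDeriv i f ∘ carnotDilation n m s) g :=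
      deriv_const_smul_field (s : ℂ)
        fun t : ℝ => (G.hDeriv i f ∘ carnotDilation n m s) (G.mul g (t • horizontalBasis m i))
    rw [h1, h2, hDeriv_comp_carnotDilation]
    push_cast
    ring
  exact (Finset.sum_congr rfl fun i _ => h i).trans (Finset.mul_sum _ _ _).symm

theorem isSimilarToMultiples_subLaplacian : G.subLaplacian.IsSimilarToMultiples := by
  intro c hc
  have hs : √c ≠ 0 := (Real.sqrt_pos.2 hc).ne'
  let S : CarnotL2 n m ≃L[ℂ] CarnotL2 n m :=
    ContinuousLinearEquiv.equivOfInverse (carnotDilationL2 n m hs)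
      (carnotDilationL2 n m (inv_ne_zero hs)) (carnotDilationL2_comp_inv hs)
      (fun u => by simpa using carnotDilationL2_comp_inv (inv_ne_zero hs) u)
  refine ⟨S, fun p hp => ?_⟩
  rw [← G.graph_subLaplacian] at hp ⊢
  refine map_mem_closure (f := fun p : CarnotL2 n m × CarnotL2 n m =>
    (S p.1, (c : ℂ) • S p.2)) (by fun_prop) hp fun p hp => ?_
  obtain ⟨f, rfl⟩ := G.mem_graph_subLaplacianCore.1 hp
  refine G.mem_graph_subLaplacianCore.2 ⟨⟨_, comp_carnotDilation_mem hs f.2⟩, ?_⟩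
  refine Prod.ext (carnotDilationL2_toLp hs (carnotTestFunctions_memLp f)).symm ?_
  change _ = (c : ℂ) • carnotDilationL2 n m hs (carnotTestToL2 n m (G.subLaplacianTest f))
  rw [← map_smul, ← map_smul]
  refine Eq.trans ?_ (carnotDilationL2_toLp hs (carnotTestFunctions_memLp _)).symm
  refine (MemLp.toLp_eq_toLp_iff (carnotTestFunctions_memLp _) _).2
    (Eventually.of_forall fun g => ?_)
  rw [G.subLaplacianTest_apply]
  refine (congrFun (G.subLaplacianFun_comp_carnotDilation √c f.1) g).trans ?_
  rw [Real.sq_sqrt hc.le, ← G.subLaplacianTest_apply]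
  rfl

end StepTwoCarnotGroup

end Dilation

/-! ### Translations and mollification -/

namespace StepTwoCarnotGroup

variable {n m : ℕ} (G : StepTwoCarnotGroup n m)

theorem mul_assoc' (a b c : CarnotPoint n m) : G.mul (G.mul a b) c = G.mul a (G.mul b c) := by
  refine Prod.ext ?_ ?_
  · simp only [mul, add_assoc]
  · simp only [mul, map_add, LinearMap.add_apply, smul_add]
    abel

theorem mul_neg_self (a : CarnotPoint n m) : G.mul a (-a) = 0 := by
  simp [mul, G.bracket_self, Prod.ext_iff]

theorem neg_mul_self (a : CarnotPoint n m) : G.mul (-a) a = 0 := by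
  simp [mul, G.bracket_self, Prod.ext_iff]

theorem zero_mul' (a : CarnotPoint n m) : G.mul 0 a = a := by simp [mul]

theorem mul_zero' (a : CarnotPoint n m) : G.mul a 0 = a := by simp [mul]

theorem contDiff_mul {X : Type*} [NormedAddCommGroup X] [NormedSpace ℝ X] {k : WithTop ℕ∞}
    {a b : X → CarnotPoint n m} (ha : ContDiff ℝ k a) (hb : ContDiff ℝ k b) :
    ContDiff ℝ k fun x => G.mul (a x) (b x) :=
  (ha.fst.add hb.fst).prodMk
    ((ha.snd.add hb.snd).add ((G.contDiff_bracket ha.fst hb.fst).const_smul _))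

theorem continuous_mul {X : Type*} [TopologicalSpace X] {a b : X → CarnotPoint n m}
    (ha : Continuous a) (hb : Continuous b) : Continuous fun x => G.mul (a x) (b x) :=
  (G.contDiff_mul (k := 0) contDiff_fst contDiff_snd).continuous.comp (ha.prodMk hb)

/-- Left translation by `a` as a homeomorphism. -/
noncomputable def leftMulHomeomorph (a : CarnotPoint n m) :
    CarnotPoint n m ≃ₜ CarnotPoint n m where
  toFun := G.mul a
  invFun := G.mul (-a)
  left_inv g := by rw [← mul_assoc', neg_mul_self, zero_mul']
  right_inv g := by rw [← mul_assoc', mul_neg_self, zero_mul']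
  continuous_toFun := G.continuous_mul continuous_const continuous_id
  continuous_invFun := G.continuous_mul continuous_const continuous_id

theorem measurePreserving_mul_left (a : CarnotPoint n m) :
    MeasurePreserving (G.mul a) volume volume := by
  have hm : Measurable fun p : CarnotPoint n m => (G.mul a p).2 :=
    (G.leftMulHomeomorph a).continuous.measurable.snd
  refine (measurePreserving_add_left volume a.1).skew_product
    (g := fun h v => a.2 + v + (1 / 2 : ℝ) • G.bracket a.1 h) hm (Eventually.of_forall fun h => ?_)
  have : (fun v => a.2 + v + (1 / 2 : ℝ) • G.bracket a.1 h) =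
      fun v => (a.2 + (1 / 2 : ℝ) • G.bracket a.1 h) + v := by funext v; abel
  rw [this]
  exact map_add_left_eq_self volume _

theorem measurePreserving_mul_right (b : CarnotPoint n m) :
    MeasurePreserving (fun g => G.mul g b) volume volume := by
  have hm : Measurable fun p : CarnotPoint n m => (G.mul p b).2 :=
    (G.continuous_mul continuous_id continuous_const).measurable.snd
  refine (measurePreserving_add_right volume b.1).skew_product
    (g := fun h v => v + b.2 + (1 / 2 : ℝ) • G.bracket h b.1) hm (Eventually.of_forall fun h => ?_)
  have : (fun v => v + b.2 + (1 / 2 : ℝ) • G.bracket h b.1) =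
      fun v => v + (b.2 + (1 / 2 : ℝ) • G.bracket h b.1) := by funext v; abel
  rw [this]
  exact map_add_right_eq_self volume _

theorem measurePreserving_prodMk_mul_neg :
    MeasurePreserving (fun p : CarnotPoint n m × CarnotPoint n m => (p.1, G.mul p.2 (-p.1)))
      volume volume :=
  (MeasurePreserving.id volume).skew_product (g := fun x g => G.mul g (-x))
    (G.continuous_mul continuous_snd continuous_fst.neg).measurable
    (Eventually.of_forall fun x => (G.measurePreserving_mul_right (-x)).map_eq)

theorem comp_mul_left_mem (a : CarnotPoint n m) {f : CarnotPoint n m → ℂ}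
    (hf : f ∈ carnotTestFunctions n m) : f ∘ G.mul a ∈ carnotTestFunctions n m :=
  ⟨hf.1.comp (G.contDiff_mul contDiff_const contDiff_id),
    hf.2.comp_homeomorph (G.leftMulHomeomorph a)⟩

theorem hDeriv_comp_mul_left (i : Fin n) (a : CarnotPoint n m) (f : CarnotPoint n m → ℂ) :
    G.hDeriv i (f ∘ G.mul a) = G.hDeriv i f ∘ G.mul a := by
  funext g
  simp only [hDeriv, leftInvariant, Function.comp_apply, mul_assoc']

theorem subLaplacianFun_comp_mul_left (a : CarnotPoint n m) (f : CarnotPoint n m → ℂ) :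
    G.subLaplacianFun (f ∘ G.mul a) = G.subLaplacianFun f ∘ G.mul a := by
  funext g
  refine Finset.sum_congr rfl fun i _ => ?_
  change G.hDeriv i (G.hDeriv i (f ∘ G.mul a)) g = G.hDeriv i (G.hDeriv i f) (G.mul a g)
  rw [hDeriv_comp_mul_left, hDeriv_comp_mul_left]
  rfl

/-- The left convolution `(ψ * u)(g) = ∫ ψ(g ⋆ x⁻¹) u(x) dx`. It commutes with left-invariant
vector fields. -/
noncomputable def leftConv (ψ u : CarnotPoint n m → ℂ) (g : CarnotPoint n m) : ℂ :=
  ∫ x, u x * ψ (G.mul g (-x))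

/-- In exponential coordinates `ψ * u` is an additive convolution whose kernel depends on the
horizontal part of the argument as a parameter. -/
theorem contDiff_leftConv {ψ u : CarnotPoint n m → ℂ} (hψ : ψ ∈ carnotTestFunctions n m)
    (hu : LocallyIntegrable u) : ContDiff ℝ ∞ (G.leftConv ψ u) := by
  let γ : CarnotPoint n m → CarnotPoint n m → ℂ := fun p z =>
    ψ (z.1, z.2 + (1 / 2 : ℝ) • G.bracket p.1 z.1)
  have hγ : ContDiff ℝ ∞ ↿γ := by
    refine hψ.1.comp ?_
    exact contDiff_snd.fst.prodMk (contDiff_snd.snd.add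
      ((G.contDiff_bracket contDiff_fst.fst contDiff_snd.fst).const_smul _))
  have heq : ∀ g, G.leftConv ψ u g =
      convolution u (γ g) (ContinuousLinearMap.mul ℝ ℂ) volume g := fun g => by
    refine integral_congr_ae (Eventually.of_forall fun x => ?_)
    simp only [ContinuousLinearMap.mul_apply', γ]
    congr 2
    refine Prod.ext (sub_eq_add_neg _ _).symm ?_
    simp only [mul, Prod.fst_sub, Prod.snd_sub, Prod.fst_neg, Prod.snd_neg, map_sub, map_neg,
      G.bracket_self]
    module
  rw [funext heq, contDiff_iff_contDiffAt]
  intro g₀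
  -- The inverse shear; it gives one compact set that carries `γ p` for all `p` near `g₀`.
  let κ : CarnotPoint n m × CarnotPoint n m → CarnotPoint n m := fun q =>
    (q.2.1, q.2.2 - (1 / 2 : ℝ) • G.bracket q.1.1 q.2.1)
  have hκ : Continuous κ := by
    have : ContDiff ℝ 0 κ := contDiff_snd.fst.prodMk (contDiff_snd.snd.sub
      ((G.contDiff_bracket contDiff_fst.fst contDiff_snd.fst).const_smul _))
    exact this.continuous
  have hK : IsCompact (κ '' (Metric.closedBall g₀ 1 ×ˢ tsupport ψ)) :=
    ((isCompact_closedBall g₀ 1).prod hψ.2).image hκ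
  have h := contDiffOn_convolution_right_with_param_comp (n := ⊤) (μ := volume)
    (ContinuousLinearMap.mul ℝ ℂ) (v := id) contDiffOn_id Metric.isOpen_ball hK
    (f := u) (g := γ) (s := Metric.ball g₀ 1) ?_ hu hγ.contDiffOn
  · exact h.contDiffAt (Metric.isOpen_ball.mem_nhds (Metric.mem_ball_self one_pos))
  · intro p z hp hz
    by_contra hne
    refine hz ⟨(p, (z.1, z.2 + (1 / 2 : ℝ) • G.bracket p.1 z.1)),
      ⟨Metric.ball_subset_closedBall hp, subset_tsupport _ hne⟩, ?_⟩
    exact Prod.ext rfl (add_sub_cancel_right _ _)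

theorem integrable_mul_comp_mul {ψ u F : CarnotPoint n m → ℂ}
    (hψ : ψ ∈ carnotTestFunctions n m) (hu : LocallyIntegrable u)
    (hF : F ∈ carnotTestFunctions n m) :
    Integrable (fun p : CarnotPoint n m × CarnotPoint n m =>
      F (G.mul p.2 p.1) * (u p.1 * ψ p.2)) volume := by
  let κ : CarnotPoint n m × CarnotPoint n m → CarnotPoint n m := fun q => G.mul (-q.1) q.2
  have hK : IsCompact (κ '' (tsupport ψ ×ˢ tsupport F)) :=
    (hψ.2.isCompact.prod hF.2).image (G.continuous_mul continuous_fst.neg continuous_snd)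
  have h1 : Integrable ((κ '' (tsupport ψ ×ˢ tsupport F)).indicator u) :=
    (hu.integrableOn_isCompact hK).integrable_indicator hK.measurableSet
  have h2 : Integrable ψ := hψ.1.continuous.integrable_of_hasCompactSupport hψ.2
  obtain ⟨C, hC⟩ := hF.2.exists_bound_of_continuous hF.1.continuous
  have h3 := (h1.mul_prod h2).bdd_mul (c := C)
    (hF.1.continuous.comp (G.continuous_mul continuous_snd continuous_fst)).aestronglyMeasurable
    (Eventually.of_forall fun p => hC _)
  refine h3.congr (Eventually.of_forall fun p => ?_)
  by_cases hp : p.1 ∈ κ '' (tsupport ψ ×ˢ tsupport F)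
  · simp [Set.indicator_of_mem hp]
  · by_cases hp1 : p.2 ∈ tsupport ψ
    · have hp2 : G.mul p.2 p.1 ∉ tsupport F := fun h => hp ⟨(p.2, G.mul p.2 p.1), ⟨hp1, h⟩, by
        simp only [κ]
        rw [← mul_assoc', neg_mul_self, zero_mul']⟩
      simp [image_eq_zero_of_notMem_tsupport hp2]
    · simp [image_eq_zero_of_notMem_tsupport hp1]

theorem integral_leftConv_mul {ψ u F : CarnotPoint n m → ℂ}
    (hψ : ψ ∈ carnotTestFunctions n m) (hu : LocallyIntegrable u)
    (hF : F ∈ carnotTestFunctions n m) :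
    ∫ g, G.leftConv ψ u g * F g = ∫ a, ψ a * ∫ x, F (G.mul a x) * u x := by
  have hint := G.integrable_mul_comp_mul hψ hu hF
  have hT := G.measurePreserving_prodMk_mul_neg
  have hint' := hT.integrable_comp_of_integrable hint
  have h1 : (∫ p : CarnotPoint n m × CarnotPoint n m, F (G.mul p.2 p.1) * (u p.1 * ψ p.2)) =
      ∫ a, ψ a * ∫ x, F (G.mul a x) * u x := by
    rw [Measure.volume_eq_prod, integral_prod_symm _ hint]
    refine integral_congr_ae (Eventually.of_forall fun a => ?_)
    simp only
    rw [← integral_const_mul]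
    refine integral_congr_ae (Eventually.of_forall fun x => ?_)
    simp only
    ring
  rw [← h1]
  have h2 := integral_map hT.measurable.aemeasurable
    (f := fun p : CarnotPoint n m × CarnotPoint n m => F (G.mul p.2 p.1) * (u p.1 * ψ p.2))
    (by rw [hT.map_eq]; exact hint.1)
  rw [hT.map_eq] at h2
  rw [h2]
  refine Eq.trans ?_ (integral_prod_symm _ hint').symm
  refine integral_congr_ae (Eventually.of_forall fun g => ?_)
  simp only [leftConv, Function.comp_apply]
  rw [← integral_mul_const]
  refine integral_congr_ae (Eventually.of_forall fun x => ?_)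
  simp only
  rw [mul_assoc', neg_mul_self, mul_zero']
  ring

theorem norm_carnotTestToL2_comp_mul_left (a : CarnotPoint n m) (f : carnotTestFunctions n m) :
    ‖carnotTestToL2 n m ⟨_, G.comp_mul_left_mem a f.2⟩‖ = ‖carnotTestToL2 n m f‖ := by
  rw [norm_carnotTestToL2, norm_carnotTestToL2, eLpNorm_comp_measurePreserving
    (carnotTestFunctions_memLp f).1 (G.measurePreserving_mul_left a)]

theorem norm_integral_mul_le (f : carnotTestFunctions n m) (u : CarnotL2 n m) :
    ‖∫ x, f.1 x * u x‖ ≤ ‖carnotTestToL2 n m f‖ * ‖u‖ := by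
  have h := inner_carnotTestToL2_left ⟨_, conj_mem_carnotTestFunctions f.2⟩ u
  simp only [Complex.conj_conj] at h
  rw [← h]
  refine (norm_inner_le_norm _ _).trans_eq (congrArg (· * ‖u‖) ?_)
  rw [norm_carnotTestToL2, norm_carnotTestToL2]
  congr 1
  exact eLpNorm_congr_norm_ae (Eventually.of_forall fun x => RCLike.norm_conj _)

theorem norm_integral_leftConv_mul_le {ψ : CarnotPoint n m → ℂ}
    (hψ : ψ ∈ carnotTestFunctions n m) (u : CarnotL2 n m) (f : carnotTestFunctions n m) :
    ‖∫ g, G.leftConv ψ u g * f.1 g‖ ≤ (∫ a, ‖ψ a‖) * ‖u‖ * ‖carnotTestToL2 n m f‖ := by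
  rw [G.integral_leftConv_mul hψ u.locallyIntegrable f.2]
  have h2 : Integrable ψ := hψ.1.continuous.integrable_of_hasCompactSupport hψ.2
  refine (norm_integral_le_of_norm_le (h2.norm.mul_const (‖u‖ * ‖carnotTestToL2 n m f‖))
    (Eventually.of_forall fun a => ?_)).trans_eq ?_
  · rw [norm_mul]
    refine mul_le_mul_of_nonneg_left ?_ (norm_nonneg _)
    have := norm_integral_mul_le ⟨_, G.comp_mul_left_mem a f.2⟩ u
    rw [G.norm_carnotTestToL2_comp_mul_left, mul_comm] at this
    exact this
  · rw [integral_mul_const, _root_.mul_assoc]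

/-- A weak solution of `(1 - Δ) u = 0` stays one under left convolution. -/
theorem integral_leftConv_mul_eq_zero {ψ : CarnotPoint n m → ℂ}
    (hψ : ψ ∈ carnotTestFunctions n m) {u : CarnotL2 n m}
    (hu : ∀ f ∈ carnotTestFunctions n m, ∫ x, (f x - G.subLaplacianFun f x) * u x = 0)
    {f : CarnotPoint n m → ℂ} (hf : f ∈ carnotTestFunctions n m) :
    ∫ g, G.leftConv ψ u g * (f g - G.subLaplacianFun f g) = 0 := by
  have h := G.integral_leftConv_mul hψ u.locallyIntegrable
    ((carnotTestFunctions n m).sub_mem hf (G.subLaplacianFun_mem hf))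
  refine h.trans ?_
  have h0 : ∀ a, ∫ x, (f - G.subLaplacianFun f) (G.mul a x) * u x = 0 := fun a => by
    rw [← hu _ (G.comp_mul_left_mem a hf), G.subLaplacianFun_comp_mul_left]
    rfl
  simp only [h0, mul_zero, integral_zero]

end StepTwoCarnotGroup

/-! ### Square integrable solutions of `Δ v = v` vanish -/

namespace StepTwoCarnotGroup

variable {n m : ℕ} (G : StepTwoCarnotGroup n m)

/-- The product of a smooth function and a test function, as a test function. -/
def mulTest {v : CarnotPoint n m → ℂ} (hv : ContDiff ℝ ∞ v) (χ : carnotTestFunctions n m) :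
    carnotTestFunctions n m := ⟨_, mul_mem_carnotTestFunctions hv χ.2⟩

theorem norm_carnotTestToL2_sq (f : carnotTestFunctions n m) :
    ‖carnotTestToL2 n m f‖ ^ 2 = (∫ g, starRingEnd ℂ (f.1 g) * f.1 g).re := by
  rw [← inner_carnotTestToL2]
  exact norm_sq_eq_re_inner (𝕜 := ℂ) _

/-- The Caccioppoli inequality, with `χ² v̄` as test function in the equation for `v`. -/
theorem norm_mulTest_sq_le {v : CarnotPoint n m → ℂ} (hv : ContDiff ℝ ∞ v)
    (hw : ∀ f ∈ carnotTestFunctions n m, ∫ g, v g * (f g - G.subLaplacianFun f g) = 0)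
    (χ : carnotTestFunctions n m) (hχ : ∀ g, starRingEnd ℂ (χ.1 g) = χ.1 g) :
    ‖carnotTestToL2 n m (mulTest hv χ)‖ ^ 2 ≤
      ∑ i, ‖carnotTestToL2 n m (mulTest hv (G.hDerivTest i χ))‖ ^ 2 := by
  have hdv : Differentiable ℝ v := hv.differentiable (by simp)
  have hdχ : Differentiable ℝ χ.1 := χ.2.1.differentiable (by simp)
  have hdcv : Differentiable ℝ fun g => starRingEnd ℂ (v g) :=
    Complex.conjCLE.differentiable.comp hdv
  let q : carnotTestFunctions n m := mulTest χ.2.1 χ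
  let f : carnotTestFunctions n m := mulTest (Complex.conjCLE.contDiff.comp hv) q
  have hf : ∀ g, f.1 g = starRingEnd ℂ (v g) * (χ.1 g * χ.1 g) := fun g => rfl
  have hreal : ∀ i g, starRingEnd ℂ (G.hDeriv i χ.1 g) = G.hDeriv i χ.1 g := fun i g => by
    rw [← G.hDeriv_conj i hdχ]
    exact congrFun (congrArg (G.hDeriv i) (funext hχ)) g
  have h1 : ∫ g, v g * f.1 g = -∑ i, ∫ g, G.hDeriv i v g * G.hDeriv i f.1 g := by
    rw [← G.integral_mul_subLaplacianFun hv f.2, ← sub_eq_zero,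
      ← integral_sub (integrable_mul hv.continuous f.2)
        (integrable_mul hv.continuous (G.subLaplacianFun_mem f.2)), ← hw f.1 f.2]
    simp only [mul_sub]
  have h2 : ‖carnotTestToL2 n m (mulTest hv χ)‖ ^ 2 = (∫ g, v g * f.1 g).re := by
    rw [norm_carnotTestToL2_sq]
    refine congrArg Complex.re (integral_congr_ae (Eventually.of_forall fun g => ?_))
    simp only [mulTest, map_mul, hχ, hf]
    ring
  have h3 : ∀ i, (∫ g, G.hDeriv i v g * G.hDeriv i f.1 g).re =
      ‖carnotTestToL2 n m (G.hDerivTest i (mulTest hv χ))‖ ^ 2 -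
        ‖carnotTestToL2 n m (mulTest hv (G.hDerivTest i χ))‖ ^ 2 := fun i => by
    set a := G.hDerivTest i (mulTest hv χ) with ha
    set b := mulTest hv (G.hDerivTest i χ) with hb
    have hia : Integrable fun g => starRingEnd ℂ (a.1 g) * a.1 g :=
      integrable_mul (conj_mem_carnotTestFunctions a.2).1.continuous a.2
    have hib : Integrable fun g => starRingEnd ℂ (b.1 g) * b.1 g :=
      integrable_mul (conj_mem_carnotTestFunctions b.2).1.continuous b.2
    have hif := integrable_mul (G.contDiff_hDeriv i hv).continuous (G.hDeriv_mem i f.2)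
    rw [norm_carnotTestToL2_sq, norm_carnotTestToL2_sq, ← Complex.sub_re,
      ← integral_sub hia hib]
    refine ((integral_re hif).symm.trans ?_).trans (integral_re (hia.sub hib))
    refine integral_congr_ae (Eventually.of_forall fun g => ?_)
    have e1 : a.1 g = v g * G.hDeriv i χ.1 g + G.hDeriv i v g * χ.1 g :=
      G.hDeriv_mul i hdv hdχ g
    have e2 : b.1 g = v g * G.hDeriv i χ.1 g := rfl
    have e3 : G.hDeriv i f.1 g =
        starRingEnd ℂ (v g) * (χ.1 g * G.hDeriv i χ.1 g + G.hDeriv i χ.1 g * χ.1 g) +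
          starRingEnd ℂ (G.hDeriv i v g) * (χ.1 g * χ.1 g) := by
      rw [← G.hDeriv_mul i hdχ hdχ g, ← G.hDeriv_conj i hdv]
      exact G.hDeriv_mul i hdcv (hdχ.mul hdχ) g
    have hx : (χ.1 g).im = 0 := Complex.conj_eq_iff_im.1 (hχ g)
    have hy : (G.hDeriv i χ.1 g).im = 0 := Complex.conj_eq_iff_im.1 (hreal i g)
    simp only [Pi.sub_apply, e1, e2, e3, RCLike.re_to_complex, Complex.mul_re, Complex.add_re,
      Complex.add_im, Complex.mul_im, Complex.sub_re, Complex.conj_re, Complex.conj_im, hx, hy,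
      map_add, map_mul, hχ, hreal]
    ring
  rw [h2, h1, Complex.neg_re, Complex.re_sum, ← Finset.sum_neg_distrib]
  refine Finset.sum_le_sum fun i _ => ?_
  rw [h3]
  linarith [sq_nonneg ‖carnotTestToL2 n m (G.hDerivTest i (mulTest hv χ))‖]

/-- If `f ↦ ∫ v f` has `L²` norm at most `C`, then `‖χ v‖ ≤ C sup |χ|`: pair `v` with `|χ|² v̄`. -/
theorem norm_mulTest_le {v : CarnotPoint n m → ℂ} (hv : ContDiff ℝ ∞ v) {C M : ℝ} (hC : 0 ≤ C)
    (hb : ∀ f : carnotTestFunctions n m, ‖∫ g, v g * f.1 g‖ ≤ C * ‖carnotTestToL2 n m f‖)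
    (χ : carnotTestFunctions n m) (hM : 0 ≤ M) (hχ : ∀ g, ‖χ.1 g‖ ≤ M) :
    ‖carnotTestToL2 n m (mulTest hv χ)‖ ≤ C * M := by
  set w := mulTest hv χ
  let f : carnotTestFunctions n m :=
    mulTest χ.2.1 ⟨_, conj_mem_carnotTestFunctions w.2⟩
  have h1 : ‖carnotTestToL2 n m f‖ ≤ M * ‖carnotTestToL2 n m w‖ := by
    refine Lp.norm_le_mul_norm_of_ae_le_mul ?_
    filter_upwards [coeFn_carnotTestToL2 f, coeFn_carnotTestToL2 w] with g e1 e2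
    rw [e1, e2]
    change ‖χ.1 g * starRingEnd ℂ (w.1 g)‖ ≤ _
    rw [norm_mul, RCLike.norm_conj]
    exact mul_le_mul_of_nonneg_right (hχ g) (norm_nonneg _)
  have h2 : ‖carnotTestToL2 n m w‖ ^ 2 ≤ C * (M * ‖carnotTestToL2 n m w‖) := by
    rw [norm_carnotTestToL2_sq]
    refine (Complex.re_le_norm _).trans (le_trans (le_of_eq ?_)
      ((hb f).trans (mul_le_mul_of_nonneg_left h1 hC)))
    refine congrArg norm (integral_congr_ae (Eventually.of_forall fun g => ?_))
    change starRingEnd ℂ (w.1 g) * (v g * χ.1 g) = v g * (χ.1 g * starRingEnd ℂ (w.1 g))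
    ring
  by_contra! hlt
  have h3 : 0 < ‖carnotTestToL2 n m w‖ := (mul_nonneg hC hM).trans_lt hlt
  nlinarith

theorem norm_carnotDilation_le {s : ℝ} (hs : 0 ≤ s) (hs1 : s ≤ 1) (g : CarnotPoint n m) :
    ‖carnotDilation n m s g‖ ≤ s * ‖g‖ := by
  rw [carnotDilation_apply, Prod.norm_def]
  refine max_le ?_ ?_
  · rw [norm_smul, Real.norm_of_nonneg hs]
    exact mul_le_mul_of_nonneg_left (norm_fst_le g) hs
  · rw [norm_smul, Real.norm_of_nonneg (sq_nonneg s)]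
    exact mul_le_mul (by nlinarith) (norm_snd_le g) (norm_nonneg _) hs

/-- A real test function with values in `[0, 1]` that is `1` on the unit ball. -/
theorem exists_cutoff (n m : ℕ) : ∃ χ : carnotTestFunctions n m,
    (∀ g, starRingEnd ℂ (χ.1 g) = χ.1 g) ∧ ∀ g, ‖g‖ ≤ 1 → χ.1 g = 1 := by
  let b : ContDiffBump (0 : CarnotPoint n m) := ⟨1, 2, one_pos, one_lt_two⟩
  refine ⟨⟨fun g => (b g : ℂ), Complex.ofRealCLM.contDiff.comp b.contDiff,
    b.hasCompactSupport.comp_left (g := fun x : ℝ => (x : ℂ)) Complex.ofReal_zero⟩,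
    fun g => Complex.conj_ofReal _, fun g hg => ?_⟩
  change (b g : ℂ) = 1
  rw [b.one_of_mem_closedBall (mem_closedBall_zero_iff.2 hg), Complex.ofReal_one]

/-- For the dilated cutoffs `χ_s = χ ∘ δ_s` the right side of the Caccioppoli inequality is
`O(s²)`, whereas `χ_s = 1` on any given compact set once `s` is small. -/
theorem eq_zero_of_weak_solution {v : CarnotPoint n m → ℂ} (hv : ContDiff ℝ ∞ v) {C : ℝ}
    (hC : 0 ≤ C)
    (hb : ∀ f : carnotTestFunctions n m, ‖∫ g, v g * f.1 g‖ ≤ C * ‖carnotTestToL2 n m f‖)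
    (hw : ∀ f ∈ carnotTestFunctions n m, ∫ g, v g * (f g - G.subLaplacianFun f g) = 0) :
    v = 0 := by
  obtain ⟨χ, hreal, hone⟩ := exists_cutoff n m
  choose M hM using fun i : Fin n =>
    (G.hDerivTest i χ).2.2.exists_bound_of_continuous (G.hDerivTest i χ).2.1.continuous
  have hM0 : ∀ i, 0 ≤ M i := fun i => (norm_nonneg _).trans (hM i 0)
  set D := ∑ i, (C * M i) ^ 2 with hD
  have key : ∀ s : ℝ, ∀ hs : 0 < s,
      ‖carnotTestToL2 n m (mulTest hv ⟨_, comp_carnotDilation_mem hs.ne' χ.2⟩)‖ ^ 2 ≤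
        s ^ 2 * D := by
    intro s hs
    refine (G.norm_mulTest_sq_le hv hw _ fun g => hreal (carnotDilation n m s g)).trans ?_
    rw [hD, Finset.mul_sum]
    refine Finset.sum_le_sum fun i _ => ?_
    rw [← mul_pow]
    refine pow_le_pow_left₀ (norm_nonneg _) ?_ 2
    rw [mul_left_comm]
    refine norm_mulTest_le hv hC hb _ (mul_nonneg hs.le (hM0 i)) fun g => ?_
    change ‖G.hDeriv i (χ.1 ∘ carnotDilation n m s) g‖ ≤ _
    rw [G.hDeriv_comp_carnotDilation, norm_mul, Complex.norm_real, Real.norm_of_nonneg hs.le]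
    exact mul_le_mul_of_nonneg_left (hM i _) hs.le
  have hzero : ∀ f ∈ carnotTestFunctions n m, ∫ g, f g * v g = 0 := by
    intro f hf
    obtain ⟨ρ, hρ0, hρ⟩ := hf.2.isCompact.isBounded.exists_pos_norm_le
    set K := ‖carnotTestToL2 n m ⟨_, conj_mem_carnotTestFunctions hf⟩‖ with hK
    have hle : ∀ s ∈ Set.Ioo (0 : ℝ) (min 1 ρ⁻¹), ‖∫ g, f g * v g‖ ≤ K * (s * √D) := by
      intro s hs
      have hs1 : s ≤ 1 := hs.2.le.trans (min_le_left _ _)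
      have hsρ : s * ρ ≤ 1 := by
        have := mul_le_mul_of_nonneg_right (hs.2.le.trans (min_le_right _ _)) hρ0.le
        rwa [inv_mul_cancel₀ hρ0.ne'] at this
      set w := mulTest hv ⟨_, comp_carnotDilation_mem hs.1.ne' χ.2⟩ with hw'
      have h1 : ∫ g, f g * v g =
          inner ℂ (carnotTestToL2 n m ⟨_, conj_mem_carnotTestFunctions hf⟩)
            (carnotTestToL2 n m w) := by
        rw [inner_carnotTestToL2]
        refine integral_congr_ae (Eventually.of_forall fun g => ?_)
        simp only [Complex.conj_conj]
        by_cases hg : g ∈ tsupport f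
        · have h2 : χ.1 (carnotDilation n m s g) = 1 := hone _
            ((norm_carnotDilation_le hs.1.le hs1 g).trans
              ((mul_le_mul_of_nonneg_left (hρ g hg) hs.1.le).trans hsρ))
          change f g * v g = f g * (v g * χ.1 (carnotDilation n m s g))
          rw [h2, mul_one]
        · rw [image_eq_zero_of_notMem_tsupport hg, zero_mul, zero_mul]
      rw [h1]
      refine (norm_inner_le_norm _ _).trans (mul_le_mul_of_nonneg_left ?_ (norm_nonneg _))
      refine Real.le_sqrt_of_sq_le (key s hs.1) |>.trans_eq ?_
      rw [Real.sqrt_mul (sq_nonneg s), Real.sqrt_sq hs.1.le]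
    have hlim : Tendsto (fun s : ℝ => K * (s * √D)) (𝓝[>] 0) (𝓝 0) := by
      have h : Continuous fun s : ℝ => K * (s * √D) := by fun_prop
      simpa using (h.tendsto 0).mono_left nhdsWithin_le_nhds
    refine norm_le_zero_iff.1 (ge_of_tendsto hlim ?_)
    filter_upwards [Ioo_mem_nhdsGT (lt_min one_pos (inv_pos.2 hρ0))] with s hs
    exact hle s hs
  have h0 := ae_eq_zero_of_integral_mul_carnotTest hv.continuous.locallyIntegrable hzero
  exact (Continuous.ae_eq_iff_eq volume hv.continuous continuous_zero).1 h0

theorem eq_zero_of_integral_sub_subLaplacian_mul_eq_zero {u : CarnotL2 n m}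
    (hu : ∀ f ∈ carnotTestFunctions n m, ∫ x, (f x - G.subLaplacianFun f x) * u x = 0) :
    u = 0 := by
  rw [Lp.eq_zero_iff_ae_eq_zero]
  refine ae_eq_zero_of_integral_mul_carnotTest u.locallyIntegrable fun f hf => ?_
  let ψ : CarnotPoint n m → ℂ := f ∘ Neg.neg
  have hψ : ψ ∈ carnotTestFunctions n m :=
    ⟨hf.1.comp contDiff_neg, hf.2.comp_homeomorph (Homeomorph.neg _)⟩
  have h := G.eq_zero_of_weak_solution (G.contDiff_leftConv hψ u.locallyIntegrable)
    (mul_nonneg (integral_nonneg fun a => norm_nonneg (ψ a)) (norm_nonneg u))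
    (G.norm_integral_leftConv_mul_le hψ u)
    (fun f hf => G.integral_leftConv_mul_eq_zero hψ hu hf)
  -- The value at the unit of the mollified function is the pairing with `f`.
  have h0 := congrFun h 0
  rw [leftConv] at h0
  simp only [zero_mul', ψ, Function.comp_apply, neg_neg, Pi.zero_apply] at h0
  rw [← h0]
  exact integral_congr_ae (Eventually.of_forall fun x => mul_comm _ _)

theorem isNonposSelfAdjoint_subLaplacian : G.subLaplacian.IsNonposSelfAdjoint := by
  refine LinearPMap.isNonposSelfAdjoint_closure G.dense_domain_subLaplacianCore
    G.symm_subLaplacianCore G.nonpos_subLaplacianCore fun u hu => ?_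
  -- The weak equation holds for the conjugate of `u`.
  have hstar : star u = 0 :=
    G.eq_zero_of_integral_sub_subLaplacian_mul_eq_zero fun f hf => ?_
  · rw [Lp.eq_zero_iff_ae_eq_zero] at hstar ⊢
    filter_upwards [hstar, Lp.coeFn_star u] with g h1 h2
    rw [h1] at h2
    exact star_eq_zero.1 h2.symm
  have h := hu _ (G.mem_graph_subLaplacianCore.2 ⟨⟨f, hf⟩, rfl⟩)
  rw [← inner_conj_symm, map_eq_zero, ← map_sub, inner_carnotTestToL2_left] at h
  have h2 := congrArg (starRingEnd ℂ) h
  rw [← integral_conj, map_zero] at h2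
  rw [← h2]
  refine integral_congr_ae ?_
  filter_upwards [Lp.coeFn_star u] with g hg
  rw [hg, map_mul, Complex.conj_conj, AddSubgroupClass.coe_sub, Pi.sub_apply,
    G.subLaplacianTest_apply]
  rfl

end StepTwoCarnotGroup

instance (n m : ℕ) : Nontrivial (CarnotL2 n m) := by
  obtain ⟨χ, -, hone⟩ := StepTwoCarnotGroup.exists_cutoff n m
  refine ⟨carnotTestToL2 n m χ, 0, fun h => ?_⟩
  have h1 : χ = 0 := carnotTestToL2_injective n m (by rw [h, map_zero])
  have h2 := hone 0 (by simp)
  rw [h1] at h2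
  exact zero_ne_one h2

instance (n m : ℕ) : TopologicalSpace.SeparableSpace (CarnotL2 n m) := by
  have : Fact ((2 : ENNReal) ≠ ⊤) := ⟨by simp⟩
  have : MeasureTheory.IsSeparable (volume : Measure (CarnotPoint n m)) :=
    instIsSeparableOfCountablyGeneratedOfSFinite _
  infer_instance

theorem mainTheorem4 {n m : ℕ} (G : StepTwoCarnotGroup n m) (t : ℝ≥0) (ht : 0 < t) :
    spectrum ℂ (G.horizontalHeatSemigroup t) = continuousSpectrum (G.horizontalHeatSemigroup t) ∧
    continuousSpectrum (G.horizontalHeatSemigroup t) =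
      (fun x : ℝ => (x : ℂ)) '' Set.Icc (0 : ℝ) 1 :=
  G.isNonposSelfAdjoint_subLaplacian.spectrum_semigroupGeneratedBy
    (fun _ => G.eq_zero_of_mem_graph_subLaplacian) G.isSimilarToMultiples_subLaplacian ht
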